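/- **Setting.** Let $\mathcal A=\{\ell_1,\dots,\ell_n,\ell'_1,\dots,\ell'_m\}$ be an arrangement of distinct affine lines in $\mathbb C^2$ defined over $\mathbb R$, where the $\ell_i$ (horizontal lines) are graphs $y=a_ix+b_i$ and the $\ell'_j$ (vertical lines) are $x=\xi_j$. Let $M(\mathcal A)$ be its complement, $\pi(x,y)=x$, and let $S$ be the set of points lying on at least two lines of $\mathcal A$. Assume that $S$ is contained in the union of the vertical lines. For $x\in\mathbb C$ put $F_x=\{y:(x,y)\in M(\mathcal A)\}$. Let $L$ be a rank one complex local system on $M(\mathcal A)$, and $L_x$ its restriction to $F_x$. Let $p\in\pi(S)\subset\mathbb R$, let $x\in\mathbb R$ with $x\ne p$ be very close to $p$ (i.e. $0<|x-p|<\varepsilon$ with $\varepsilon>0$ depending only on $\mathcal A$ and $p$, and no point of $\pi(S)$ other than $p$ is at distance $\le|x-p|$ from $p$), and let $x'=2p-x$. Index the horizontal lines according to their growing intersections $y_1<\dots<y_n$ with the real axis of $\pi^{-1}(x)$. Take a base point $y_0$ with $\operatorname{Im}y_0>|a_i|\,|x-p|$ for all $i$; let $\alpha_k$ be the loop in $F_x$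 which goes from $y_0$ along a segment to a small circle around $y_k$, travels once counterclockwise around it and comes back, and let $s_k\in\mathbb C^*$ be the number by which $L$ acts along $\alpha_k$. Assume $s_k\neq1$ for all $k$. Singular $1$-chains with coefficients in $L_x$ have boundary $\partial c=L(c)\,c(1)-c(0)$, with $L(c)$ the transport of $L$ along $c$, and we consider in $H_1(F_x;L_x)$ the classes $$\alpha_{i,i+1}=\frac{\alpha_i}{1-s_i}-\frac{\alpha_{i+1}}{1-s_{i+1}},\qquad 1\le i\le n-1 .$$ Let $\tau(x,x'):H_1(F_x;L_x)\to H_1(F_{x'};L_{x'})$ be the parallel transport of the bundle $M(\mathcal A)\to\mathbb C\setminus\pi(S)$ along the counterclockwise half circle with center $p$ from $x$ to $x'$, where coefficients are carried along identically at the base points $(z,y_0)$ (that is, the transport of $L$ along the path of base points is divided out), and let $\tau(x',x)$ be the one along the counterclockwise half circle from $x'$ to $x$. The local monodromy is $\mu_x=\tau(x',x)\circ\tau(x,x')$. Call two indices equivalent if the corresponding horizontal lines meet $\pi^{-1}(p)$ in the same point; the equivalence classes are the blocks of the local permutation. **Theorem (local monodromy).** $\mu_x$ is an automorphism of $H_1(F_x;L_x)$,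 and for $1\le i\le n-1$: 1. if $i$ and $i+1$ belong to the same block $\Delta$, then $$\mu_x(\alpha_{i,i+1})=\Big(\prod_{j\in\Delta}s_j\Big)\,\alpha_{i,i+1};$$ 2. if $i$ is the last element of a block $\{a,a+1,\dots,i\}$ and $i+1$ is the first element of the next block $\{i+1,i+2,\dots,b\}$, then $$\mu_x(\alpha_{i,i+1})=\alpha_{i,i+1}+\sum_{k=a}^{i-1}(1-s_a\cdots s_k)\,\alpha_{k,k+1}+\sum_{k=i+2}^{b}s_{i+1}\cdots s_{k-1}\,(1-s_k\cdots s_b)\,\alpha_{k-1,k}.$$ -/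

import Mathlib

open scoped unitInterval
open Set

noncomputable section

/-! ### Rank one local systems and first homology with local coefficients -/

/-- A rank one local system of `K`-vector spaces, all stalks being identified with `K`: transport
along a path is multiplication by a non-zero number which depends only on the homotopy class of the
path relative to its end points, and which is multiplicative under concatenation. -/
structure RankOneLocalSystem (K : Type*) [Field K] (X : Type*) [TopologicalSpace X] where
  tr : C(I, X) → Kˣ
  tr_homotopic : ∀ {x y : X} (c d : Path x y), c.Homotopic d →
    tr c.toContinuousMap = tr d.toContinuousMap
  tr_trans : ∀ {x y z : X} (c : Path x y) (d : Path y z),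
    tr (c.trans d).toContinuousMap = tr c.toContinuousMap * tr d.toContinuousMap

namespace RankOneLocalSystem

variable {K X Y : Type*} [Field K] [TopologicalSpace X] [TopologicalSpace Y]

/-- Pull-back of a local system along a continuous map. -/
def comap (f : C(X, Y)) (L : RankOneLocalSystem K Y) : RankOneLocalSystem K X where
  tr c := L.tr (f.comp c)
  tr_homotopic c d h := L.tr_homotopic (c.map f.continuous) (d.map f.continuous) (h.map f)
  tr_trans c d := by
    have h := L.tr_trans (c.map f.continuous) (d.map f.continuous)
    rw [← Path.map_trans] at h
    exact h

end RankOneLocalSystem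

namespace TwistedHomology

/-- The edge of the standard `2`-simplex from the vertex `i` to the vertex `j`. -/
def edge (i j : Fin 3) : C(I, stdSimplex ℝ (Fin 3)) where
  toFun t := ⟨(1 - (t : ℝ)) • Pi.single i 1 + (t : ℝ) • Pi.single j 1,
    (convex_stdSimplex ℝ (Fin 3)) (single_mem_stdSimplex ℝ i) (single_mem_stdSimplex ℝ j)
      (sub_nonneg.2 t.2.2) t.2.1 (by ring)⟩
  continuous_toFun := by fun_prop

variable {K X Y : Type*} [Field K] [TopologicalSpace X] [TopologicalSpace Y]

/-- Boundary of singular `1`-chains with coefficients in a rank one local system. The coefficient of a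
singular simplex lives in the stalk at its first vertex; singular `1`-simplices are parametrized by
the unit interval. -/
def boundary₁ (L : RankOneLocalSystem K X) : (C(I, X) →₀ K) →ₗ[K] (X →₀ K) :=
  Finsupp.linearCombination K fun c =>
    Finsupp.single (c 1) (L.tr c : K) - Finsupp.single (c 0) 1

/-- Boundary of singular `2`-chains with coefficients in a rank one local system. -/
def boundary₂ (L : RankOneLocalSystem K X) :
    (C(stdSimplex ℝ (Fin 3), X) →₀ K) →ₗ[K] (C(I, X) →₀ K) :=
  Finsupp.linearCombination K fun s =>
    Finsupp.single (s.comp (edge 1 2)) (L.tr (s.comp (edge 0 1)) : K)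
      - Finsupp.single (s.comp (edge 0 2)) 1 + Finsupp.single (s.comp (edge 0 1)) 1

/-- The space of singular `1`-cycles. -/
def Cycles (L : RankOneLocalSystem K X) : Type _ := LinearMap.ker (boundary₁ L)

instance (L : RankOneLocalSystem K X) : AddCommGroup (Cycles L) :=
  Submodule.addCommGroup (M := C(I, X) →₀ K) (LinearMap.ker (boundary₁ L))

instance (L : RankOneLocalSystem K X) : Module K (Cycles L) :=
  Submodule.module (LinearMap.ker (boundary₁ L))

/-- The inclusion of the cycles in the `1`-chains. -/
def cyclesIncl (L : RankOneLocalSystem K X) : Cycles L →ₗ[K] (C(I, X) →₀ K) :=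
  (LinearMap.ker (boundary₁ L)).subtype

/-- The first singular homology group `H₁(X; L)`: cycles modulo boundaries. -/
abbrev H₁ (L : RankOneLocalSystem K X) : Type _ :=
  Cycles L ⧸ (LinearMap.range (boundary₂ L)).comap (cyclesIncl L)

/-- The map on singular `1`-chains given by composition with a continuous map. -/
def chainMap (g : C(X, Y)) : (C(I, X) →₀ K) →ₗ[K] (C(I, Y) →₀ K) :=
  Finsupp.lmapDomain K K fun c => g.comp c

theorem boundary₁_chainMap (L : RankOneLocalSystem K X) (L' : RankOneLocalSystem K Y) (g : C(X, Y))
    (hg : ∀ c, L.tr c = L'.tr (g.comp c)) (u : C(I, X) →₀ K) :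
    boundary₁ L' (chainMap g u) = Finsupp.lmapDomain K K g (boundary₁ L u) := by
  induction u using Finsupp.induction_linear with
  | zero => simp only [map_zero]
  | add f g hf hg => simp only [map_add, hf, hg]
  | single c a =>
    simp only [boundary₁, chainMap, Finsupp.lmapDomain_apply, Finsupp.mapDomain_single,
      Finsupp.linearCombination_single, hg]
    rw [← Finsupp.lmapDomain_apply K K, map_smul, map_sub]
    simp only [Finsupp.lmapDomain_apply, Finsupp.mapDomain_single, ContinuousMap.comp_apply]

theorem chainMap_boundary₂ (L : RankOneLocalSystem K X) (L' : RankOneLocalSystem K Y) (g : C(X, Y))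
    (hg : ∀ c, L.tr c = L'.tr (g.comp c)) (u : C(stdSimplex ℝ (Fin 3), X) →₀ K) :
    chainMap g (boundary₂ L u) =
      boundary₂ L' (Finsupp.lmapDomain K K (fun s => g.comp s) u) := by
  induction u using Finsupp.induction_linear with
  | zero => simp only [map_zero]
  | add f g hf hg => simp only [map_add, hf, hg]
  | single c a =>
    simp only [boundary₂, Finsupp.lmapDomain_apply, Finsupp.mapDomain_single,
      Finsupp.linearCombination_single, hg, map_smul, map_sub, map_add, chainMap,
      ContinuousMap.comp_assoc]

/-- The map induced on cycles. -/
def cyclesMap (L : RankOneLocalSystem K X) (L' : RankOneLocalSystem K Y) (g : C(X, Y))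
    (hg : ∀ c, L.tr c = L'.tr (g.comp c)) : Cycles L →ₗ[K] Cycles L' :=
  (chainMap g).restrict (p := LinearMap.ker (boundary₁ L)) (q := LinearMap.ker (boundary₁ L'))
    fun u hu => by
      rw [LinearMap.mem_ker] at hu ⊢
      rw [boundary₁_chainMap L L' g hg, hu, map_zero]

/-- The map induced in homology by a continuous map `g`, where the local system on the source is the
pull-back by `g` of the one on the target. -/
def H₁map (L : RankOneLocalSystem K X) (L' : RankOneLocalSystem K Y) (g : C(X, Y))
    (hg : ∀ c, L.tr c = L'.tr (g.comp c)) : H₁ L →ₗ[K] H₁ L' :=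
  Submodule.mapQ _ _ (cyclesMap L L' g hg) fun u hu => by
    obtain ⟨w, hw⟩ := hu
    refine ⟨Finsupp.lmapDomain K K (fun s => g.comp s) w, ?_⟩
    rw [← chainMap_boundary₂ L L' g hg, hw]
    rfl

end TwistedHomology

open TwistedHomology

/-! ### Real line arrangements and the projection onto the first coordinate -/

/-- An affine line arrangement in `ℂ²`, defined over `ℝ`, with `n` horizontal lines
`y = slope i * x + icpt i` and `m` vertical lines `x = vert j`. -/
structure LineArrangement (n m : ℕ) where
  slope : Fin n → ℝ
  icpt : Fin n → ℝ
  vert : Fin m → ℝ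
  horizontal_distinct : Function.Injective fun i => (slope i, icpt i)
  vertical_distinct : Function.Injective vert

namespace LineArrangement

variable {n m : ℕ} (A : LineArrangement n m)

/-- The lines of the arrangement, as subsets of `ℂ²`. -/
def line : Fin n ⊕ Fin m → Set (ℂ × ℂ)
  | .inl i => {P | P.2 = A.slope i * P.1 + A.icpt i}
  | .inr j => {P | P.1 = A.vert j}

/-- The complement `M(A)` of the arrangement in `ℂ²`. -/
def compl : Set (ℂ × ℂ) := (⋃ k, A.line k)ᶜ

/-- The set `S` of singular points: the points lying on at least two lines. -/
def sing : Set (ℂ × ℂ) := {P | ∃ k l, k ≠ l ∧ P ∈ A.line k ∧ P ∈ A.line l}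

/-- The projection `π(S)` of the singular set. -/
def singProj : Set ℂ := Prod.fst '' A.sing

/-- The arrangement is fibered: every singular point lies on a vertical line of the arrangement, so
that `π` restricts to a fiber bundle `M(A) → ℂ \ π(S)`. -/
def Fibered : Prop := A.sing ⊆ ⋃ j, A.line (.inr j)

/-- The height at which the `i`-th line meets the vertical line over a real point `x`. -/
def height (i : Fin n) (x : ℝ) : ℝ := A.slope i * x + A.icpt i

/-- The `x`-ordering of the horizontal lines: the `k`-th line in the ordering by growing
intersection with `Re (ℂ_x)` is the line `A.order x k`. -/
def order (x : ℝ) : Equiv.Perm (Fin n) := Tuple.sort fun i => A.height i x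

/-- The `k`-th intersection point, in growing order, of the horizontal lines with `Re (ℂ_x)`. -/
def pt (x : ℝ) (k : Fin n) : ℝ := A.height (A.order x k) x

/-- The fiber `F_x` of the projection `M(A) → ℂ`, as a subset of the `y`-line. -/
def Fiber (x : ℂ) : Set ℂ := {y | (x, y) ∈ A.compl}

def fiberIncl (x : ℂ) : C(A.Fiber x, A.compl) where
  toFun y := ⟨(x, y), y.2⟩
  continuous_toFun := by fun_prop

/-- The restriction `L_x` to `F_x` of a local system on the complement. -/
def fiberSystem (L : RankOneLocalSystem ℂ A.compl) (x : ℂ) : RankOneLocalSystem ℂ (A.Fiber x) :=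
  L.comap (A.fiberIncl x)

/-! ### Parallel transport -/

section Transport

variable {A} {z w : ℂ} (γ : Path z w)

variable (A) in
/-- The pull-back of `M(A) → ℂ` along a path `γ` in the base. -/
def Pullback : Set (I × ℂ) := {q | (γ q.1, q.2) ∈ A.compl}

variable (A) in
def pullbackMap : C(A.Pullback γ, A.compl) where
  toFun q := ⟨(γ q.1.1, q.1.2), q.2⟩
  continuous_toFun := by fun_prop

variable (A) in
/-- The inclusion of the fiber over the initial point. -/
def inclSource : C(A.Fiber z, A.Pullback γ) where
  toFun y := ⟨(0, y), by simpa [Pullback, Fiber] using y.2⟩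
  continuous_toFun := by fun_prop

variable (A) in
/-- The inclusion of the fiber over the final point. -/
def inclTarget : C(A.Fiber w, A.Pullback γ) where
  toFun y := ⟨(1, y), by simpa [Pullback, Fiber] using y.2⟩
  continuous_toFun := by fun_prop

variable (L : RankOneLocalSystem ℂ A.compl)

def inclSourceH₁ : H₁ (A.fiberSystem L z) →ₗ[ℂ] H₁ (L.comap (A.pullbackMap γ)) :=
  H₁map _ _ (A.inclSource γ) fun c => congrArg L.tr <| by
    ext t <;> simp [fiberIncl, pullbackMap, inclSource]

def inclTargetH₁ : H₁ (A.fiberSystem L w) →ₗ[ℂ] H₁ (L.comap (A.pullbackMap γ)) :=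
  H₁map _ _ (A.inclTarget γ) fun c => congrArg L.tr <| by
    ext t <;> simp [fiberIncl, pullbackMap, inclTarget]

/-- The path `t ↦ (γ t, y₀)` in the complement traced by the base points `(x, y₀)` of the fibers. -/
def sectionPath (y₀ : ℂ) (h : ∀ t, (γ t, y₀) ∈ A.compl) : C(I, A.compl) where
  toFun t := ⟨(γ t, y₀), h t⟩
  continuous_toFun := by fun_prop

open Classical in
/-- The parallel transport `H₁(F_z; L_z) → H₁(F_w; L_w)` along a path `γ` from `z` to `w`. The two
inclusions of `F_z` and `F_w` in the pull-back of the bundle along `γ` induce isomorphisms in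
homology, and the parallel transport is the second inverse composed with the first. The stalks of
`L` at the base points `(z, y₀)` and `(w, y₀)` are both the standard `ℂ`, and the coefficients are
carried along identically at the base points; hence the normalization by the transport of `L` along
the path of base points. (In the degenerate case in which the second inclusion does not induce an
isomorphism, the value is `0`.) -/
def transport (y₀ : ℂ) (h : ∀ t, (γ t, y₀) ∈ A.compl) :
    H₁ (A.fiberSystem L z) →ₗ[ℂ] H₁ (A.fiberSystem L w) :=
  if hb : Function.Bijective (inclTargetH₁ γ L) then
    ((L.tr (sectionPath γ y₀ h))⁻¹ : ℂˣ) •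
      ((LinearEquiv.ofBijective _ hb).symm.toLinearMap ∘ₗ inclSourceH₁ γ L)
  else 0

end Transport

/-! ### The local situation around a point of `π(S)` -/

/-- The half circle with center `p` traveled counterclockwise from `x` to the symmetric point `x'`. -/
def halfCircle {p x x' : ℝ} (h : x + x' = 2 * p) : Path (x : ℂ) (x' : ℂ) where
  toFun t := p + (x - p) * Complex.exp (Real.pi * (t : ℝ) * Complex.I)
  continuous_toFun := by fun_prop
  source' := by simp
  target' := by
    have : (x : ℂ) + x' = 2 * p := by exact_mod_cast h
    simp only [unitInterval, Icc.coe_one, Complex.ofReal_one, mul_one, Complex.exp_pi_mul_I]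
    linear_combination -this

/-- The choices made to define the local monodromy around `p ∈ π(S)`: two real points `x`, `x'`
symmetric with respect to `p`, such that no other point of `π(S)` is as close to `p`, and the second
coordinate `y₀` of the base points, whose imaginary part is larger than that of all the intersections
of the horizontal lines with the fibers over the circle with center `p` through `x`. -/
structure LocalData {p : ℝ} (hp : (p : ℂ) ∈ A.singProj) where
  x : ℝ
  x' : ℝ
  y₀ : ℂ
  symmetric : x + x' = 2 * p
  ne : x ≠ p
  near : ∀ q ∈ A.singProj, q ≠ p → |x - p| < ‖q - p‖
  above : ∀ i, |A.slope i| * |x - p| < y₀.im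

namespace LocalData

variable {A} {p : ℝ} {hp : (p : ℂ) ∈ A.singProj} (D : A.LocalData hp)

/-- The same choices with the roles of `x` and `x'` exchanged. -/
def swap : A.LocalData hp where
  x := D.x'
  x' := D.x
  y₀ := D.y₀
  symmetric := by rw [add_comm]; exact D.symmetric
  ne h := D.ne (by linarith [D.symmetric])
  near := by
    have h : D.x' - p = -(D.x - p) := by linarith [D.symmetric]
    rw [h, abs_neg]; exact D.near
  above := by
    have h : D.x' - p = -(D.x - p) := by linarith [D.symmetric]
    rw [h, abs_neg]; exact D.above

theorem nonempty_horizontal {A : LineArrangement n m} {p : ℝ} (hp : (p : ℂ) ∈ A.singProj) :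
    Nonempty (Fin n) := by
  obtain ⟨P, ⟨k, l, hkl, hk, hl⟩, -⟩ := hp
  match k, l with
  | .inl i, _ => exact ⟨i⟩
  | _, .inl i => exact ⟨i⟩
  | .inr i, .inr j =>
    simp only [line, mem_ofPred_eq] at hk hl
    have : A.vert i = A.vert j := by exact_mod_cast hk.symm.trans hl
    exact absurd (congrArg Sum.inr (A.vertical_distinct this)) hkl

theorem ne_vert {A : LineArrangement n m} {p : ℝ} {hp : (p : ℂ) ∈ A.singProj}
    (D : A.LocalData hp) {z : ℂ} (hz : ‖z - p‖ = |D.x - p|) (j : Fin m) : z ≠ A.vert j := by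
  rintro rfl
  obtain ⟨i⟩ := nonempty_horizontal hp
  have hj : (A.vert j : ℂ) ∈ A.singProj :=
    ⟨(A.vert j, A.slope i * A.vert j + A.icpt i), ⟨.inl i, .inr j, by simp, rfl, rfl⟩, rfl⟩
  by_cases h : (A.vert j : ℂ) = p
  · rw [h, sub_self, norm_zero] at hz
    exact D.ne (sub_eq_zero.1 (abs_eq_zero.1 hz.symm))
  · exact (D.near _ hj h).ne hz.symm

theorem y₀_im_pos : 0 < D.y₀.im := by
  obtain ⟨i⟩ := nonempty_horizontal hp
  exact (mul_nonneg (abs_nonneg _) (abs_nonneg _)).trans_lt (D.above i)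

theorem mem_compl_of_norm {z : ℂ} (hz : ‖z - p‖ = |D.x - p|) : (z, D.y₀) ∈ A.compl := by
  simp only [compl, mem_compl_iff, mem_iUnion, not_exists]
  rintro (i | j) h
  · simp only [line, mem_ofPred_eq] at h
    have h1 : D.y₀.im = A.slope i * (z - p).im := by rw [h]; simp
    have h2 : A.slope i * (z - p).im ≤ |A.slope i| * |D.x - p| := by
      rw [← hz]
      exact (le_abs_self _).trans <| by
        rw [abs_mul]
        exact mul_le_mul_of_nonneg_left (Complex.abs_im_le_norm _) (abs_nonneg _)
    exact absurd (D.above i) (by rw [h1]; exact h2.not_gt)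
  · exact D.ne_vert hz j h

theorem section_mem (t : I) : (halfCircle D.symmetric t, D.y₀) ∈ A.compl := by
  refine D.mem_compl_of_norm ?_
  have h : ‖Complex.exp (Real.pi * (t : ℝ) * Complex.I)‖ = 1 := by
    rw [← Complex.ofReal_mul]; exact Complex.norm_exp_ofReal_mul_I _
  change ‖(p : ℂ) + (D.x - p) * Complex.exp (Real.pi * (t : ℝ) * Complex.I) - p‖ = _
  rw [add_sub_cancel_left, norm_mul, h, mul_one, ← Complex.ofReal_sub, Complex.norm_real,
    Real.norm_eq_abs]

/-! #### Elementary generators of the fundamental group of the fiber -/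

/-- Radius of the small circle around the `k`-th point: half the distance from it to the other
points and to `y₀`. -/
def radius (k : Fin n) : ℝ :=
  Metric.infDist (A.pt D.x k : ℂ)
    (insert D.y₀ (range fun l => (A.pt D.x l : ℂ)) \ {(A.pt D.x k : ℂ)}) / 2

/-- The point where the segment from `y₀` to the `k`-th point meets the small circle around it. -/
def foot (k : Fin n) : ℂ :=
  A.pt D.x k + (D.radius k / ‖D.y₀ - A.pt D.x k‖ : ℝ) * (D.y₀ - A.pt D.x k)

/-- The small circle around the `k`-th point, traveled once counterclockwise. -/
def circle (k : Fin n) : Path (D.foot k) (D.foot k) where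
  toFun t := A.pt D.x k + (D.foot k - A.pt D.x k) * Complex.exp (2 * Real.pi * (t : ℝ) * Complex.I)
  continuous_toFun := by fun_prop
  source' := by simp
  target' := by simp [Complex.exp_two_pi_mul_I]

/-- The loop at `y₀` in the `y`-line which goes straight to the small circle around the `k`-th
point, travels once around it counterclockwise, and comes back. -/
def loopInPlane (k : Fin n) : Path D.y₀ D.y₀ :=
  ((Path.segment D.y₀ (D.foot k)).trans (D.circle k)).trans (Path.segment D.y₀ (D.foot k)).symm

theorem y₀_ne_real (r : ℝ) : D.y₀ ≠ r := fun h => by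
  have := D.y₀_im_pos; rw [h] at this; simp at this

theorem radius_pos (k : Fin n) : 0 < D.radius k := by
  have hne : (insert D.y₀ (range fun l => (A.pt D.x l : ℂ)) \ {(A.pt D.x k : ℂ)}).Nonempty :=
    ⟨D.y₀, mem_insert _ _, D.y₀_ne_real _⟩
  have hfin : (insert D.y₀ (range fun l => (A.pt D.x l : ℂ)) \ {(A.pt D.x k : ℂ)}).Finite :=
    ((finite_range _).insert _).subset sdiff_subset
  exact half_pos ((hfin.isClosed.notMem_iff_infDist_pos hne).1 fun h => h.2 rfl)

theorem radius_lt (k : Fin n) {q : ℂ} (hq : q ∈ insert D.y₀ (range fun l => (A.pt D.x l : ℂ)))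
    (hk : q ≠ A.pt D.x k) : D.radius k < ‖q - A.pt D.x k‖ := by
  have h := Metric.infDist_le_dist_of_mem (x := (A.pt D.x k : ℂ)) (show q ∈
    insert D.y₀ (range fun l => (A.pt D.x l : ℂ)) \ {(A.pt D.x k : ℂ)} from ⟨hq, hk⟩)
  rw [dist_comm, dist_eq_norm] at h
  have h1 := D.radius_pos k
  unfold radius at h1 ⊢
  linarith

/-- A point over `x` lies in the fiber as soon as it differs from the `n` marked points. -/
theorem mem_fiber {y : ℂ} (hy : ∀ k, y ≠ A.pt D.x k) : y ∈ A.Fiber D.x := by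
  simp only [Fiber, compl, mem_compl_iff, mem_iUnion, not_exists, mem_ofPred_eq]
  rintro (i | j) h
  · apply hy ((A.order D.x).symm i)
    simpa [line, pt, height] using h
  · exact D.ne_vert (by rw [← Complex.ofReal_sub, Complex.norm_real, Real.norm_eq_abs]) j h

theorem segment_mem (k : Fin n) (t : I) : Path.segment D.y₀ (D.foot k) t ∈ A.Fiber D.x := by
  refine D.mem_fiber fun l h => ?_
  have hpos : 0 < ‖D.y₀ - A.pt D.x k‖ := norm_pos_iff.2 (sub_ne_zero.2 (D.y₀_ne_real _))
  have hc : 0 < D.radius k / ‖D.y₀ - A.pt D.x k‖ := div_pos (D.radius_pos k) hpos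
  have hf : (D.foot k).im = D.radius k / ‖D.y₀ - A.pt D.x k‖ * D.y₀.im := by
    simp only [foot, Complex.add_im, Complex.im_ofReal_mul, Complex.sub_im, Complex.ofReal_im,
      zero_add, sub_zero]
  have hy := D.y₀_im_pos
  obtain ⟨t, ht0, ht1⟩ := t
  have him := congrArg Complex.im h
  simp only [Path.segment_apply, AffineMap.lineMap_apply, vsub_eq_sub, vadd_eq_add,
    Complex.add_im, Complex.real_smul, Complex.im_ofReal_mul, Complex.sub_im, Complex.ofReal_im,
    hf] at him
  generalize D.radius k / ‖D.y₀ - A.pt D.x k‖ = c at him hc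
  have : ((1 - t) + t * c) * D.y₀.im = 0 := by linarith
  rcases mul_eq_zero.1 this with h | h
  · rcases eq_or_lt_of_le ht0 with h0 | h0
    · subst h0; norm_num at h
    · nlinarith [mul_pos h0 hc]
  · exact hy.ne' h

theorem circle_mem (k : Fin n) (t : I) : D.circle k t ∈ A.Fiber D.x := by
  refine D.mem_fiber fun l h => ?_
  have hpos : 0 < ‖D.y₀ - A.pt D.x k‖ := norm_pos_iff.2 (sub_ne_zero.2 (D.y₀_ne_real _))
  have h1 : ‖Complex.exp (2 * Real.pi * (t : ℝ) * Complex.I)‖ = 1 := by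
    have := Complex.norm_exp_ofReal_mul_I (2 * Real.pi * (t : ℝ))
    push_cast at this; exact this
  have hr : ‖(A.pt D.x l : ℂ) - A.pt D.x k‖ = D.radius k := by
    rw [← h]
    change ‖(A.pt D.x k : ℂ) + (D.foot k - A.pt D.x k) *
      Complex.exp (2 * Real.pi * (t : ℝ) * Complex.I) - A.pt D.x k‖ = _
    rw [add_sub_cancel_left, norm_mul, h1, mul_one, foot, add_sub_cancel_left, norm_mul,
      Complex.norm_real, Real.norm_eq_abs, abs_of_pos (div_pos (D.radius_pos k) hpos),
      div_mul_cancel₀ _ hpos.ne']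
  refine (D.radius_lt k (mem_insert_of_mem _ ⟨l, rfl⟩) fun hlk => ?_).ne' hr
  change (A.pt D.x l : ℂ) = A.pt D.x k at hlk
  rw [hlk, sub_self, norm_zero] at hr
  exact (D.radius_pos k).ne hr

theorem loop_mem (k : Fin n) (t : I) : D.loopInPlane k t ∈ A.Fiber D.x := by
  have h : range (D.loopInPlane k) ⊆ A.Fiber D.x := by
    rw [loopInPlane, Path.trans_range, Path.trans_range, Path.symm_range, union_subset_iff,
      union_subset_iff]
    exact ⟨⟨range_subset_iff.2 (D.segment_mem k), range_subset_iff.2 (D.circle_mem k)⟩,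
      range_subset_iff.2 (D.segment_mem k)⟩
  exact h (mem_range_self t)

/-- The elementary generator `α_k` of the fundamental group of `F_x`, as a loop in `F_x`. -/
def loop (k : Fin n) : C(I, A.Fiber D.x) where
  toFun t := ⟨D.loopInPlane k t, D.loop_mem k t⟩
  continuous_toFun := by fun_prop

/-! #### Homology classes, local monodromy and blocks -/

variable (L : RankOneLocalSystem ℂ A.compl)

/-- The parameter `s_k` of the `k`-th line in the `x`-ordering: the number by which `L` acts on a
small positive circle around this line. -/
def param (k : Fin n) : ℂˣ := (A.fiberSystem L D.x).tr (D.loop k)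

variable {L}

/-- The class of the cycle `α_i / (1 - s_i) - α_j / (1 - s_j)`; for `j = i + 1` this is
`α_{i,i+1}`. -/
def alpha (hs : ∀ k, (D.param L k : ℂ) ≠ 1) (i j : Fin n) : H₁ (A.fiberSystem L D.x) :=
  Submodule.mkQ _ ⟨Finsupp.single (D.loop i) (1 - (D.param L i : ℂ))⁻¹
      - Finsupp.single (D.loop j) (1 - (D.param L j : ℂ))⁻¹, by
    have h0 : ∀ k, D.loop k 0 = D.loop i 0 := fun k => Subtype.ext (by
      change D.loopInPlane k 0 = D.loopInPlane i 0; simp)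
    have h1 : ∀ k, D.loop k 1 = D.loop i 0 := fun k => Subtype.ext (by
      change D.loopInPlane k 1 = D.loopInPlane i 0; simp)
    have key : ∀ k, boundary₁ (A.fiberSystem L D.x)
        (Finsupp.single (D.loop k) (1 - (D.param L k : ℂ))⁻¹) =
          Finsupp.single (D.loop i 0) (-1) := fun k => by
      have hk : 1 - (D.param L k : ℂ) ≠ 0 := sub_ne_zero.2 (hs k).symm
      rw [boundary₁, Finsupp.linearCombination_single, h0, h1, ← Finsupp.single_sub,
        Finsupp.smul_single]
      congr 1
      change _ • ((D.param L k : ℂ) - 1) = _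
      rw [smul_eq_mul, inv_mul_eq_div, div_eq_iff hk]; ring
    rw [LinearMap.mem_ker, map_sub, key, key, sub_self]⟩

variable (L)

/-- The local monodromy `μ_x = τ(x', x) ∘ τ(x, x')`: the parallel transport once around the circle
with center `p` through `x`, counterclockwise. -/
def monodromy : H₁ (A.fiberSystem L D.x) →ₗ[ℂ] H₁ (A.fiberSystem L D.x) :=
  transport (halfCircle D.swap.symmetric) L D.y₀ D.swap.section_mem ∘ₗ
    transport (halfCircle D.symmetric) L D.y₀ D.section_mem

/-- The block of the local permutation containing `i`: all the `x`-indices of the horizontal lines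
which meet the vertical line over `p` at the same point as the `i`-th line in the `x`-ordering. -/
def block (i : Fin n) : Finset (Fin n) :=
  Finset.univ.filter fun j => A.height (A.order D.x j) p = A.height (A.order D.x i) p

end LocalData

end LineArrangement

end

/-! Over the circle with center `p` through `x` the horizontal lines read `y = h + a (z - p)`, where
`h` is the height over `p`. The points of one block therefore rotate rigidly around their common
height. When `x` is close to `p` they lie in a small disc, and the discs of different blocks do not
overlap. A flow that turns the discs, is damped to the identity in surrounding annuli and fixes `y₀`
trivializes the bundle over each half circle. Hence the local monodromy is induced by the full
rotation of the discs (`Radii.exists_monodromy_eq`). It sends each loop `α_k` to `β α_k β⁻¹`, where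
`β = α_a ⋯ α_b` is the loop around the disc of its block (`val_twist_loop`, `blockLoop_eq`).

To read this in homology, note that classes of paths modulo boundaries satisfy `[c d] = [c] + L(c)
[d]`. So `c ↦ (v ↦ L(c) v + [c])` is a homotopy invariant with values in an affine group,
multiplicative under concatenation (`affineRep`). The affine map of `α_k` has linear part `s_k` and
fixes `e_k = α_k / (1 - s_k)`. Conjugation by `β` then says that the monodromy sends `e_k` to
`β(e_k)` (`normLoop_twist`), and `α_{i,i+1} = e_i - e_{i+1}`.

Within a block, both terms are moved by the same affine map, so their difference is multiplied by
its linear part `∏ s_j`. Across two blocks, `β(e_i)` and `β'(e_{i+1})` are expanded factor by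
factor, each factor being applied to its fixed point; this yields the two sums
(`shift_add_mult_smul_last`, `shift_add_mult_smul_first`).

The plane topology is reduced to "gates": paths from the upper to the lower half plane through one
real point. Every loop involved is a quotient of two gates, and a gate depends only on the gap
between the marked points that it crosses. -/

noncomputable section

open TwistedHomology

/-! ### Multiplicative invariants of paths -/

/-- A homotopy invariant of paths with values in a group `G` which is multiplicative under
concatenation: a representation of the fundamental groupoid in `G`. -/
structure PathRep (X G : Type*) [TopologicalSpace X] [Group G] where
  val : C(I, X) → G
  val_homotopic : ∀ {x y : X} (c d : Path x y), c.Homotopic d →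
    val c.toContinuousMap = val d.toContinuousMap
  val_trans : ∀ {x y z : X} (c : Path x y) (d : Path y z),
    val (c.trans d).toContinuousMap = val c.toContinuousMap * val d.toContinuousMap

/-- The singular segment from `p` to `q`, pushed forward by `T`. -/
def ContinuousMap.segmentCurve {E X : Type*} [AddCommGroup E] [Module ℝ E] [TopologicalSpace E]
    [ContinuousAdd E] [ContinuousSMul ℝ E] [TopologicalSpace X] (T : C(E, X)) (p q : E) : C(I, X) :=
  T.comp (Path.segment p q).toContinuousMap

/-- A continuous map on the unit square, extended to the plane. -/
def squareExtend {X : Type*} [TopologicalSpace X] (H : C(I × I, X)) : C(ℝ × ℝ, X) where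
  toFun q := H (projIcc 0 1 zero_le_one q.1, projIcc 0 1 zero_le_one q.2)
  continuous_toFun := by
    have := continuous_projIcc (a := (0 : ℝ)) (b := 1) (h := zero_le_one)
    fun_prop

section Square

variable {X : Type*} [TopologicalSpace X] (H : C(I × I, X))

/-- The curve `t ↦ H (s, t)`. -/
def rowCurve (s : I) : C(I, X) := H.comp ⟨fun t => (s, t), by fun_prop⟩

/-- The curve `s ↦ H (s, t)`. -/
def colCurve (t : I) : C(I, X) := H.comp ⟨fun s => (s, t), by fun_prop⟩

theorem squareExtend_segment_row (s : I) :
    (squareExtend H).segmentCurve ((s : ℝ), (0 : ℝ)) ((s : ℝ), (1 : ℝ)) = rowCurve H s := by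
  ext t
  simp [ContinuousMap.segmentCurve, squareExtend, rowCurve, AffineMap.lineMap_apply]

theorem squareExtend_segment_col (t : I) :
    (squareExtend H).segmentCurve ((0 : ℝ), (t : ℝ)) ((1 : ℝ), (t : ℝ)) = colCurve H t := by
  ext s
  simp [ContinuousMap.segmentCurve, squareExtend, colCurve, AffineMap.lineMap_apply]

end Square

namespace PathRep

variable {X Y G : Type*} [TopologicalSpace X] [TopologicalSpace Y] [Group G] (R : PathRep X G)

theorem val_const (x : X) : R.val (ContinuousMap.const I x) = 1 := by
  have h := R.val_trans (Path.refl x) (Path.refl x)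
  rw [Path.refl_trans_refl] at h
  exact left_eq_mul.1 h

theorem val_symm {x y : X} (c : Path x y) :
    R.val c.symm.toContinuousMap = (R.val c.toContinuousMap)⁻¹ := by
  have h := R.val_homotopic _ _ (Path.Homotopic.trans_symm c)
  rw [R.val_trans] at h
  exact eq_inv_of_mul_eq_one_right (h.trans (R.val_const x))

/-- Pull-back of an invariant of paths along a continuous map. -/
def comap (f : C(X, Y)) (R : PathRep Y G) : PathRep X G where
  val c := R.val (f.comp c)
  val_homotopic c d h := R.val_homotopic (c.map f.continuous) (d.map f.continuous) (h.map f)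
  val_trans c d := by
    have h := R.val_trans (c.map f.continuous) (d.map f.continuous)
    rw [← Path.map_trans] at h
    exact h

/-- A topological vector space is simply connected, so the two sides of the triangle are homotopic
to the third before being pushed forward by `T`. -/
theorem val_segmentCurve {E : Type*} [AddCommGroup E] [Module ℝ E] [TopologicalSpace E]
    [ContinuousAdd E] [ContinuousSMul ℝ E] (T : C(E, X)) (p q r : E) :
    R.val (T.segmentCurve p q) * R.val (T.segmentCurve q r) = R.val (T.segmentCurve p r) := by
  have h := R.val_homotopic _ _ ((SimplyConnectedSpace.paths_homotopic
    ((Path.segment p q).trans (Path.segment q r)) (Path.segment p r)).map T)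
  rw [Path.map_trans, R.val_trans] at h
  exact h

/-- Both ways around the square are equal to its diagonal. -/
theorem val_square (H : C(I × I, X)) :
    R.val (rowCurve H 0) * R.val (colCurve H 1) = R.val (colCurve H 0) * R.val (rowCurve H 1) := by
  rw [← squareExtend_segment_row, ← squareExtend_segment_col, ← squareExtend_segment_row,
    ← squareExtend_segment_col]
  simp only [Icc.coe_zero, Icc.coe_one, R.val_segmentCurve]

end PathRep

/-- The invariant of paths given by the transport of a rank one local system. -/
def RankOneLocalSystem.pathRep {K X : Type*} [Field K] [TopologicalSpace X]
    (L : RankOneLocalSystem K X) : PathRep X Kˣ := ⟨L.tr, L.tr_homotopic, L.tr_trans⟩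

namespace TwistedHomology

variable {K X Y Z : Type*} [Field K] [TopologicalSpace X] [TopologicalSpace Y] [TopologicalSpace Z]

/-! ### Singular `1`-chains modulo boundaries -/

/-- Singular `1`-chains modulo boundaries. -/
abbrev ChainClasses (L : RankOneLocalSystem K X) : Type _ :=
  (C(I, X) →₀ K) ⧸ LinearMap.range (boundary₂ L)

/-- The class of a singular `1`-simplex modulo boundaries. -/
def cls (L : RankOneLocalSystem K X) (c : C(I, X)) : ChainClasses L :=
  Submodule.Quotient.mk (Finsupp.single c 1)

/-- The first homology group embeds in the chains modulo boundaries. -/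
def toChainClasses (L : RankOneLocalSystem K X) : H₁ L →ₗ[K] ChainClasses L :=
  Submodule.mapQ _ _ (cyclesIncl L) le_rfl

theorem toChainClasses_mk (L : RankOneLocalSystem K X) (z : Cycles L) :
    toChainClasses L (Submodule.Quotient.mk z) = Submodule.Quotient.mk (cyclesIncl L z) := rfl

/-- The relations of `H₁` are exactly the boundaries that lie among the cycles. Identities in
homology can thus be checked on single simplices, which need not be cycles. -/
theorem toChainClasses_injective (L : RankOneLocalSystem K X) :
    Function.Injective (toChainClasses L) := by
  rw [injective_iff_map_eq_zero]
  intro z hz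
  induction z using Submodule.Quotient.induction_on with
  | H z =>
    rw [toChainClasses_mk, Submodule.Quotient.mk_eq_zero] at hz
    exact (Submodule.Quotient.mk_eq_zero _).2 hz

theorem mk_single (L : RankOneLocalSystem K X) (c : C(I, X)) (a : K) :
    (Submodule.Quotient.mk (Finsupp.single c a) : ChainClasses L) = a • cls L c := by
  rw [cls, ← Submodule.Quotient.mk_smul, Finsupp.smul_single, smul_eq_mul, mul_one]

theorem cls_triangle (L : RankOneLocalSystem K X) (s : C(stdSimplex ℝ (Fin 3), X)) :
    cls L (s.comp (edge 0 2)) =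
      cls L (s.comp (edge 0 1)) + (L.tr (s.comp (edge 0 1)) : K) • cls L (s.comp (edge 1 2)) := by
  rw [← mk_single, cls, cls, ← Submodule.Quotient.mk_add, Submodule.Quotient.eq,
    ← Submodule.neg_mem_iff]
  refine ⟨Finsupp.single s 1, ?_⟩
  rw [boundary₂, Finsupp.linearCombination_single, one_smul]
  abel

/-- The relation is the one given by the affine singular triangle with vertices `p`, `q`, `r`, which
may be degenerate. -/
theorem cls_segmentCurve (L : RankOneLocalSystem K X) {E : Type*} [AddCommGroup E] [Module ℝ E]
    [TopologicalSpace E] [ContinuousAdd E] [ContinuousSMul ℝ E] (T : C(E, X)) (p q r : E) :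
    cls L (T.segmentCurve p r) =
      cls L (T.segmentCurve p q) + (L.tr (T.segmentCurve p q) : K) • cls L (T.segmentCurve q r) := by
  have hc : Continuous fun x : stdSimplex ℝ (Fin 3) => x.1 0 • p + x.1 1 • q + x.1 2 • r := by
    have : ∀ i, Continuous fun x : stdSimplex ℝ (Fin 3) => x.1 i := fun i =>
      (continuous_apply i).comp continuous_subtype_val
    exact ((((this 0).smul continuous_const).add ((this 1).smul continuous_const)).add
      ((this 2).smul continuous_const))
  have h := cls_triangle L (T.comp ⟨_, hc⟩)
  have h01 : (T.comp ⟨_, hc⟩).comp (edge 0 1) = T.segmentCurve p q := by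
    ext t
    simp [edge, ContinuousMap.segmentCurve, AffineMap.lineMap_apply_module]
  have h12 : (T.comp ⟨_, hc⟩).comp (edge 1 2) = T.segmentCurve q r := by
    ext t
    simp [edge, ContinuousMap.segmentCurve, AffineMap.lineMap_apply_module]
  have h02 : (T.comp ⟨_, hc⟩).comp (edge 0 2) = T.segmentCurve p r := by
    ext t
    simp [edge, ContinuousMap.segmentCurve, AffineMap.lineMap_apply_module]
  rwa [h01, h12, h02] at h

/-- A constant triangle gives `v = v + a • v` with `a` invertible. -/
theorem cls_const (L : RankOneLocalSystem K X) (x : X) : cls L (ContinuousMap.const I x) = 0 := by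
  have h := cls_segmentCurve L (ContinuousMap.const ℝ x) 0 0 0
  have h1 : (ContinuousMap.const ℝ x).segmentCurve 0 0 = ContinuousMap.const I x := rfl
  rw [h1, left_eq_add, smul_eq_zero] at h
  exact h.resolve_left (Units.ne_zero _)

/-- On the real line, `c.trans d` is the segment from `0` to `1` and its two halves are `c` and `d`,
so this is the triangle relation for `0`, `1 / 2`, `1`. -/
theorem cls_trans (L : RankOneLocalSystem K X) {x y z : X} (c : Path x y) (d : Path y z) :
    cls L (c.trans d).toContinuousMap =
      cls L c.toContinuousMap + (L.tr c.toContinuousMap : K) • cls L d.toContinuousMap := by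
  have hT : Continuous (c.trans d).extend := (c.trans d).continuous_extend
  have h := cls_segmentCurve L ⟨_, hT⟩ 0 (1 / 2) 1
  have h01 : ContinuousMap.segmentCurve ⟨_, hT⟩ 0 (1 / 2) = c.toContinuousMap := by
    ext t
    have ht : (t : ℝ) / 2 ∈ I := ⟨by linarith [t.2.1], by linarith [t.2.2]⟩
    have : (t : ℝ) * (1 / 2) = (⟨t / 2, ht⟩ : I) := by simp; ring
    simp only [ContinuousMap.segmentCurve, ContinuousMap.comp_apply, ContinuousMap.coe_mk,
      Path.coe_toContinuousMap, Path.segment_apply, AffineMap.lineMap_apply_module, smul_eq_mul,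
      mul_zero, zero_add]
    rw [this, Path.extend_apply _ ht, Path.trans_apply, dif_pos (by simp; linarith [t.2.2])]
    congr 1; ext; simp; ring
  have h12 : ContinuousMap.segmentCurve ⟨_, hT⟩ (1 / 2) 1 = d.toContinuousMap := by
    ext t
    have ht : (1 + t : ℝ) / 2 ∈ I := ⟨by linarith [t.2.1], by linarith [t.2.2]⟩
    have : (1 - (t : ℝ)) * (1 / 2) + t * 1 = (⟨(1 + t) / 2, ht⟩ : I) := by simp; ring
    simp only [ContinuousMap.segmentCurve, ContinuousMap.comp_apply, ContinuousMap.coe_mk,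
      Path.coe_toContinuousMap, Path.segment_apply, AffineMap.lineMap_apply_module, smul_eq_mul]
    rw [this, Path.extend_apply _ ht, Path.trans_apply]
    split_ifs with h
    -- At the midpoint `Path.trans` still uses its first branch; there both sides are the common
    -- point `y`.
    · have h0 : t = 0 := by
        ext
        have h : (1 + (t : ℝ)) / 2 ≤ 1 / 2 := h
        exact le_antisymm (show (t : ℝ) ≤ 0 by linarith) t.2.1
      subst h0
      simp
    · congr 1; ext; simp; ring
  have h02 : ContinuousMap.segmentCurve ⟨_, hT⟩ 0 1 = (c.trans d).toContinuousMap := by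
    ext t
    simp [ContinuousMap.segmentCurve, AffineMap.lineMap_apply_module]
  rwa [h01, h12, h02] at h

theorem cls_square (L : RankOneLocalSystem K X) (H : C(I × I, X)) :
    cls L (rowCurve H 0) + (L.tr (rowCurve H 0) : K) • cls L (colCurve H 1) =
      cls L (colCurve H 0) + (L.tr (colCurve H 0) : K) • cls L (rowCurve H 1) := by
  rw [← squareExtend_segment_row, ← squareExtend_segment_col, ← squareExtend_segment_row,
    ← squareExtend_segment_col]
  simp only [Icc.coe_zero, Icc.coe_one, ← cls_segmentCurve]

/-- In the square of the homotopy the sides that trace the end points are constant, hence have class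
`0` and transport `1`. -/
theorem cls_homotopic (L : RankOneLocalSystem K X) {x y : X} (c d : Path x y)
    (h : c.Homotopic d) : cls L c.toContinuousMap = cls L d.toContinuousMap := by
  obtain ⟨F⟩ := h
  have h := cls_square L F.toContinuousMap
  have h0 : rowCurve F.toContinuousMap 0 = c.toContinuousMap := by ext t; simp [rowCurve]
  have h1 : rowCurve F.toContinuousMap 1 = d.toContinuousMap := by ext t; simp [rowCurve]
  have h2 : colCurve F.toContinuousMap 0 = ContinuousMap.const I x := by ext t; simp [colCurve]
  have h3 : colCurve F.toContinuousMap 1 = ContinuousMap.const I y := by ext t; simp [colCurve]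
  rw [h0, h1, h2, h3, cls_const, cls_const, smul_zero, add_zero, zero_add] at h
  rw [h, show L.tr (ContinuousMap.const I x) = 1 from L.pathRep.val_const x, Units.val_one, one_smul]

/-! ### The crossed homomorphism given by the classes of paths -/

/-- The group of affine transformations `v ↦ mult • v + shift` of a vector space. -/
@[ext] structure AffineElement (K V : Type*) [Field K] [AddCommGroup V] [Module K V] where
  mult : Kˣ
  shift : V

namespace AffineElement

variable {V : Type*} [AddCommGroup V] [Module K V]

/-- Composition of affine maps: with this law the rule of `cls_trans` becomes multiplicativity. -/
instance : Mul (AffineElement K V) := ⟨fun a b => ⟨a.mult * b.mult, a.shift + a.mult • b.shift⟩⟩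

instance : One (AffineElement K V) := ⟨⟨1, 0⟩⟩

instance : Inv (AffineElement K V) := ⟨fun a => ⟨a.mult⁻¹, -(a.mult⁻¹ • a.shift)⟩⟩

theorem mult_mul (a b : AffineElement K V) : (a * b).mult = a.mult * b.mult := rfl

theorem shift_mul (a b : AffineElement K V) : (a * b).shift = a.shift + a.mult • b.shift := rfl

theorem shift_inv (a : AffineElement K V) : a⁻¹.shift = -(a.mult⁻¹ • a.shift) := rfl

instance : Group (AffineElement K V) :=
  Group.ofLeftAxioms
    (fun a b c => AffineElement.ext (mul_assoc _ _ _) (by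
      simp only [shift_mul, mult_mul, smul_add, mul_smul, add_assoc]))
    (fun a => AffineElement.ext (one_mul _) (by
      change (0 : V) + (1 : Kˣ) • a.shift = a.shift
      rw [one_smul, zero_add]))
    (fun a => AffineElement.ext (inv_mul_cancel _) (by
      change -(a.mult⁻¹ • a.shift) + a.mult⁻¹ • a.shift = 0
      rw [neg_add_cancel]))

end AffineElement

/-- The transport along a path together with its class modulo boundaries. -/
def affineRep (L : RankOneLocalSystem K X) : PathRep X (AffineElement K (ChainClasses L)) where
  val c := ⟨L.tr c, cls L c⟩
  val_homotopic c d h := by rw [L.tr_homotopic c d h, cls_homotopic L c d h]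
  val_trans c d := AffineElement.ext (L.tr_trans c d) (cls_trans L c d)

/-! ### Maps between homology groups twisted by a change of stalks -/

/-- `u x` identifies the stalk of `L` at `x` with the stalk of `L'` at `g x`, compatibly with
transport. -/
def StalkMap (L : RankOneLocalSystem K X) (L' : RankOneLocalSystem K Y) (g : C(X, Y))
    (u : X → Kˣ) : Prop :=
  ∀ c : C(I, X), L.tr c * u (c 1) = u (c 0) * L'.tr (g.comp c)

theorem edge_zero (i j : Fin 3) : edge i j 0 = ⟨Pi.single i 1, single_mem_stdSimplex ℝ i⟩ := by
  ext; simp [edge]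

theorem edge_one (i j : Fin 3) : edge i j 1 = ⟨Pi.single j 1, single_mem_stdSimplex ℝ j⟩ := by
  ext; simp [edge]

/-- The map on `1`-chains given by a continuous map and a change of stalks. -/
def twChain (g : C(X, Y)) (u : X → Kˣ) : (C(I, X) →₀ K) →ₗ[K] (C(I, Y) →₀ K) :=
  Finsupp.linearCombination K fun c => Finsupp.single (g.comp c) (u (c 0) : K)

theorem twChain_single (g : C(X, Y)) (u : X → Kˣ) (c : C(I, X)) (a : K) :
    twChain g u (Finsupp.single c a) = Finsupp.single (g.comp c) (a * u (c 0)) := by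
  rw [twChain, Finsupp.linearCombination_single, Finsupp.smul_single, smul_eq_mul]

theorem boundary₁_twChain {L : RankOneLocalSystem K X} {L' : RankOneLocalSystem K Y} {g : C(X, Y)}
    {u : X → Kˣ} (h : StalkMap L L' g u) (z : C(I, X) →₀ K) :
    boundary₁ L' (twChain g u z) =
      Finsupp.linearCombination K (fun x => Finsupp.single (g x) (u x : K)) (boundary₁ L z) := by
  induction z using Finsupp.induction_linear with
  | zero => simp only [map_zero]
  | add f g hf hg => simp only [map_add, hf, hg]
  | single c a =>
    have hc := congrArg Units.val (h c)
    push_cast at hc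
    simp only [twChain_single, boundary₁, Finsupp.linearCombination_single, map_sub,
      Finsupp.smul_single, ContinuousMap.comp_apply, smul_eq_mul, smul_sub, mul_one]
    rw [mul_assoc, ← hc, mul_assoc]

/-- Only the face from vertex `1` to vertex `2` does not start at vertex `0`. Compatibility of `u`
along the edge from `0` to `1` moves its weight there, so that all three faces carry the weight of
vertex `0`. -/
theorem twChain_boundary₂ {L : RankOneLocalSystem K X} {L' : RankOneLocalSystem K Y} {g : C(X, Y)}
    {u : X → Kˣ} (h : StalkMap L L' g u) (w : C(stdSimplex ℝ (Fin 3), X) →₀ K) :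
    twChain g u (boundary₂ L w) = boundary₂ L' (Finsupp.linearCombination K
      (fun s => Finsupp.single (g.comp s) (u (s ⟨Pi.single 0 1, single_mem_stdSimplex ℝ 0⟩) : K))
        w) := by
  induction w using Finsupp.induction_linear with
  | zero => simp only [map_zero]
  | add f g hf hg => simp only [map_add, hf, hg]
  | single s a =>
    have hc := congrArg Units.val (h (s.comp (edge 0 1)))
    push_cast at hc
    simp only [ContinuousMap.comp_apply, edge_zero, edge_one] at hc
    simp only [boundary₂, Finsupp.linearCombination_single, map_sub, map_add,
      twChain_single, ContinuousMap.comp_apply, edge_zero, Finsupp.smul_single, smul_eq_mul, hc,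
      mul_one, smul_add, smul_sub, ContinuousMap.comp_assoc, mul_assoc]

/-- The map on cycles given by a continuous map and a change of stalks. -/
def twCycles {L : RankOneLocalSystem K X} {L' : RankOneLocalSystem K Y} {g : C(X, Y)}
    {u : X → Kˣ} (h : StalkMap L L' g u) : Cycles L →ₗ[K] Cycles L' :=
  (twChain g u).restrict (p := LinearMap.ker (boundary₁ L)) (q := LinearMap.ker (boundary₁ L'))
    fun z hz => by
      rw [LinearMap.mem_ker] at hz ⊢
      rw [boundary₁_twChain h, hz, map_zero]

/-- The map in homology given by a continuous map and a change of stalks. -/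
def twMap {L : RankOneLocalSystem K X} {L' : RankOneLocalSystem K Y} {g : C(X, Y)}
    {u : X → Kˣ} (h : StalkMap L L' g u) : H₁ L →ₗ[K] H₁ L' :=
  Submodule.mapQ _ _ (twCycles h) fun z hz => by
    obtain ⟨w, hw⟩ := hz
    refine ⟨_, (twChain_boundary₂ h w).symm.trans ?_⟩
    rw [hw]
    rfl

theorem toChainClasses_twMap {L : RankOneLocalSystem K X} {L' : RankOneLocalSystem K Y} {g : C(X, Y)}
    {u : X → Kˣ} (h : StalkMap L L' g u) (z : Cycles L) :
    toChainClasses L' (twMap h (Submodule.Quotient.mk z)) =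
      Submodule.Quotient.mk (twChain g u (cyclesIncl L z)) := rfl

theorem H₁_hom_ext {L : RankOneLocalSystem K X} {L' : RankOneLocalSystem K Y}
    {f g : H₁ L →ₗ[K] H₁ L'} (h : ∀ z : Cycles L,
      toChainClasses L' (f (Submodule.Quotient.mk z)) =
        toChainClasses L' (g (Submodule.Quotient.mk z))) : f = g := by
  ext z
  exact toChainClasses_injective L' (h z)

theorem StalkMap.of_tr_eq {L : RankOneLocalSystem K X} {L' : RankOneLocalSystem K Y} {g : C(X, Y)}
    (hg : ∀ c, L.tr c = L'.tr (g.comp c)) : StalkMap L L' g 1 := fun c => by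
  simp [hg]

theorem H₁map_eq_twMap (L : RankOneLocalSystem K X) (L' : RankOneLocalSystem K Y) (g : C(X, Y))
    (hg : ∀ c, L.tr c = L'.tr (g.comp c)) :
    H₁map L L' g hg = twMap (StalkMap.of_tr_eq hg) := by
  refine H₁_hom_ext fun z => ?_
  rw [toChainClasses_twMap]
  change Submodule.Quotient.mk (chainMap g (cyclesIncl L z)) = _
  congr 1
  generalize cyclesIncl L z = w
  induction w using Finsupp.induction_linear with
  | zero => simp only [map_zero]
  | add f g hf hg => simp only [map_add, hf, hg]
  | single s a =>
    rw [twChain_single, chainMap, Finsupp.lmapDomain_apply, Finsupp.mapDomain_single]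
    simp

theorem StalkMap.comp {L : RankOneLocalSystem K X} {L' : RankOneLocalSystem K Y}
    {L'' : RankOneLocalSystem K Z} {g : C(X, Y)} {u : X → Kˣ} (h : StalkMap L L' g u)
    {g' : C(Y, Z)} {u' : Y → Kˣ} (h' : StalkMap L' L'' g' u') :
    StalkMap L L'' (g'.comp g) fun x => u x * u' (g x) := fun c => by
  have := h' (g.comp c)
  simp only [ContinuousMap.comp_apply] at this
  rw [← mul_assoc, h c, mul_assoc, this, mul_assoc, ContinuousMap.comp_assoc]

theorem twMap_comp {L : RankOneLocalSystem K X} {L' : RankOneLocalSystem K Y}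
    {L'' : RankOneLocalSystem K Z} {g : C(X, Y)} {u : X → Kˣ} (h : StalkMap L L' g u)
    {g' : C(Y, Z)} {u' : Y → Kˣ} (h' : StalkMap L' L'' g' u') :
    twMap h' ∘ₗ twMap h = twMap (h.comp h') := by
  refine H₁_hom_ext fun z => ?_
  rw [toChainClasses_twMap]
  change Submodule.Quotient.mk (twChain g' u' (twChain g u (cyclesIncl L z))) = _
  congr 1
  generalize cyclesIncl L z = w
  induction w using Finsupp.induction_linear with
  | zero => simp only [map_zero]
  | add f g hf hg => simp only [map_add, hf, hg]
  | single s a =>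
    simp only [twChain_single, ContinuousMap.comp_apply, ContinuousMap.comp_assoc, Units.val_mul,
      mul_assoc]

theorem twMap_eq_id {L : RankOneLocalSystem K X} {g : C(X, X)} {u : X → Kˣ}
    (h : StalkMap L L g u) (hg : ∀ x, g x = x) (hu : ∀ x, u x = 1) : twMap h = LinearMap.id := by
  refine H₁_hom_ext fun z => ?_
  rw [toChainClasses_twMap, LinearMap.id_apply, toChainClasses_mk]
  congr 1
  generalize cyclesIncl L z = w
  induction w using Finsupp.induction_linear with
  | zero => simp only [map_zero]
  | add f g hf hg => simp only [map_add, hf, hg]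
  | single s a =>
    rw [twChain_single, hu, Units.val_one, mul_one]
    congr 1
    ext t
    exact hg _

/-- The path traced by a point under a homotopy. -/
def trackCurve (H : C(X × I, Y)) (x : X) : C(I, Y) := H.comp ⟨fun t => (x, t), by fun_prop⟩

/-- The homotopy restricted to a curve `c` is a square whose sides are `f ∘ c`, `g ∘ c` and the
tracks of the two end points of `c`. -/
theorem StalkMap.homotopy {L : RankOneLocalSystem K X} {L' : RankOneLocalSystem K Y} {f g : C(X, Y)}
    (hf : StalkMap L L' f 1) (H : C(X × I, Y)) (h0 : ∀ x, H (x, 0) = f x)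
    (h1 : ∀ x, H (x, 1) = g x) : StalkMap L L' g fun x => L'.tr (trackCurve H x) := fun c => by
  have h := L'.pathRep.val_square (H.comp ⟨fun q => (c q.2, q.1), by fun_prop⟩)
  have e0 : rowCurve (H.comp ⟨fun q : I × I => (c q.2, q.1), by fun_prop⟩) 0 = f.comp c := by
    ext t; exact h0 _
  have e1 : rowCurve (H.comp ⟨fun q : I × I => (c q.2, q.1), by fun_prop⟩) 1 = g.comp c := by
    ext t; exact h1 _
  rw [e0, e1] at h
  have hc := hf c
  simp only [Pi.one_apply, mul_one, one_mul] at hc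
  rw [hc]
  exact h

/-- Homotopy invariance of homology with local coefficients. -/
theorem twMap_homotopy {L : RankOneLocalSystem K X} {L' : RankOneLocalSystem K Y} {f g : C(X, Y)}
    (hf : StalkMap L L' f 1) (H : C(X × I, Y)) (h0 : ∀ x, H (x, 0) = f x)
    (h1 : ∀ x, H (x, 1) = g x) : twMap hf = twMap (hf.homotopy H h0 h1) := by
  refine H₁_hom_ext fun z => ?_
  rw [toChainClasses_twMap, toChainClasses_twMap]
  -- The chain homotopy formula modulo boundaries: the two images differ by the tracks of the
  -- boundary of `w`, which vanish on a cycle.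
  have key : ∀ w : C(I, X) →₀ K,
      (Submodule.Quotient.mk (twChain f 1 w) : ChainClasses L') +
        Finsupp.linearCombination K (fun x => cls L' (trackCurve H x)) (boundary₁ L w) =
      Submodule.Quotient.mk (twChain g (fun x => L'.tr (trackCurve H x)) w) := by
    intro w
    induction w using Finsupp.induction_linear with
    | zero => simp only [map_zero, add_zero, Submodule.Quotient.mk_zero]
    | add f g hf hg =>
      simp only [map_add, Submodule.Quotient.mk_add, ← hf, ← hg]
      abel
    | single c a =>
      have h := cls_square L' (H.comp ⟨fun q => (c q.2, q.1), by fun_prop⟩)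
      have e0 : rowCurve (H.comp ⟨fun q : I × I => (c q.2, q.1), by fun_prop⟩) 0 = f.comp c := by
        ext t; exact h0 _
      have e1 : rowCurve (H.comp ⟨fun q : I × I => (c q.2, q.1), by fun_prop⟩) 1 = g.comp c := by
        ext t; exact h1 _
      have e2 : ∀ t, colCurve (H.comp ⟨fun q : I × I => (c q.2, q.1), by fun_prop⟩) t =
        trackCurve H (c t) := fun t => rfl
      have hc := hf c
      simp only [Pi.one_apply, mul_one, one_mul] at hc
      rw [e0, e1, e2, e2, ← hc] at h
      rw [twChain_single, twChain_single, mk_single, mk_single, boundary₁,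
        Finsupp.linearCombination_single, map_smul, map_sub, Finsupp.linearCombination_single,
        Finsupp.linearCombination_single, one_smul, Pi.one_apply, Units.val_one, mul_one, mul_smul,
        ← smul_add]
      congr 1
      rw [← add_sub_assoc, h, add_sub_cancel_left]
  have hz : boundary₁ L (cyclesIncl L z) = 0 := z.2
  rw [← key, hz, map_zero, add_zero]

end TwistedHomology

/-! ### Changes of stalks: scalar multiples and inverses. -/

namespace TwistedHomology

variable {K X Y : Type*} [Field K] [TopologicalSpace X] [TopologicalSpace Y]
  {L : RankOneLocalSystem K X} {L' : RankOneLocalSystem K Y}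

theorem twMap_congr {g g' : C(X, Y)} {u u' : X → Kˣ} (h : StalkMap L L' g u)
    (h' : StalkMap L L' g' u') (hg : g = g') (hu : u = u') : twMap h = twMap h' := by
  subst hg hu; rfl

theorem StalkMap.const_mul {g : C(X, Y)} {u : X → Kˣ} (h : StalkMap L L' g u) (a : Kˣ) :
    StalkMap L L' g fun x => a * u x := fun c => by
  rw [mul_left_comm, h c, mul_assoc]

theorem twMap_const_mul {g : C(X, Y)} {u : X → Kˣ} (h : StalkMap L L' g u) (a : Kˣ) :
    twMap (h.const_mul a) = a • twMap h := by
  refine H₁_hom_ext fun z => ?_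
  rw [LinearMap.smul_apply, Units.smul_def, map_smul, toChainClasses_twMap, toChainClasses_twMap,
    ← Submodule.Quotient.mk_smul]
  congr 1
  generalize cyclesIncl L z = w
  induction w using Finsupp.induction_linear with
  | zero => simp only [map_zero, smul_zero]
  | add f g hf hg => simp only [map_add, hf, hg, smul_add]
  | single c b =>
    rw [twChain_single, twChain_single, Finsupp.smul_single, smul_eq_mul, Units.val_mul,
      mul_left_comm]

theorem StalkMap.inverse {g : C(X, Y)} {u : X → Kˣ} (h : StalkMap L L' g u) (g' : C(Y, X))
    (hg : g.comp g' = ContinuousMap.id Y) : StalkMap L' L g' fun y => (u (g' y))⁻¹ := fun c => by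
  have := h (g'.comp c)
  rw [← ContinuousMap.comp_assoc, hg, ContinuousMap.id_comp] at this
  simp only [ContinuousMap.comp_apply] at this
  rw [mul_inv_eq_iff_eq_mul, mul_assoc, this, inv_mul_cancel_left]

/-- A change of stalks over a homeomorphism induces an isomorphism in homology. -/
theorem twMap_bijective {g : C(X, Y)} {u : X → Kˣ} (h : StalkMap L L' g u) (g' : C(Y, X))
    (hg : g.comp g' = ContinuousMap.id Y) (hg' : g'.comp g = ContinuousMap.id X) :
    Function.Bijective (twMap h) := by
  refine Function.bijective_iff_has_inverse.2 ⟨twMap (h.inverse g' hg), fun v => ?_, fun v => ?_⟩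
  · rw [← LinearMap.comp_apply, twMap_comp, twMap_eq_id, LinearMap.id_apply]
    · exact fun x => DFunLike.congr_fun hg' x
    · intro x
      have : g' (g x) = x := DFunLike.congr_fun hg' x
      rw [this, mul_inv_cancel]
  · rw [← LinearMap.comp_apply, twMap_comp, twMap_eq_id, LinearMap.id_apply]
    · exact fun x => DFunLike.congr_fun hg x
    · intro x
      have : g (g' x) = x := DFunLike.congr_fun hg x
      exact inv_mul_cancel _

end TwistedHomology

/-! ### Parallel transport computed by a trivializing flow. -/

namespace LineArrangement

variable {n m : ℕ} {A : LineArrangement n m} {z w : ℂ}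

variable (A) in
/-- A flow of the `y`-line which trivializes the pull-back of `M(A) → ℂ` along a path. -/
structure TransportFlow (γ : Path z w) where
  flow : ℝ → ℂ → ℂ
  continuous_flow : Continuous fun q : ℝ × ℂ => flow q.1 q.2
  flow_zero : ∀ y, flow 0 y = y
  flow_add : ∀ s t y, flow s (flow t y) = flow (s + t) y
  flow_mem : ∀ (t t' : I) (y : ℂ), y ∈ A.Fiber (γ t) → flow (t' - t) y ∈ A.Fiber (γ t')

namespace TransportFlow

variable {γ : Path z w} (Φ : A.TransportFlow γ)

/-- The time one map of the flow, from the first to the last fiber. -/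
def endMap : C(A.Fiber z, A.Fiber w) where
  toFun y := ⟨Φ.flow 1 y, by simpa using Φ.flow_mem 0 1 y (by simp)⟩
  continuous_toFun := by
    refine Continuous.subtype_mk (Φ.continuous_flow.comp (g := Function.uncurry Φ.flow)
      (f := fun y : A.Fiber z => ((1 : ℝ), (y : ℂ))) ?_) _
    fun_prop

/-- The inverse of the time one map. -/
def endMapInv : C(A.Fiber w, A.Fiber z) where
  toFun y := ⟨Φ.flow (-1) y, by simpa using Φ.flow_mem 1 0 y (by simp)⟩
  continuous_toFun := by
    refine Continuous.subtype_mk (Φ.continuous_flow.comp (g := Function.uncurry Φ.flow)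
      (f := fun y : A.Fiber w => ((-1 : ℝ), (y : ℂ))) ?_) _
    fun_prop

theorem endMap_comp_inv : Φ.endMap.comp Φ.endMapInv = ContinuousMap.id _ := by
  ext y
  change Φ.flow 1 (Φ.flow (-1) y) = y
  rw [Φ.flow_add, add_neg_cancel, Φ.flow_zero]

theorem endMapInv_comp : Φ.endMapInv.comp Φ.endMap = ContinuousMap.id _ := by
  ext y
  change Φ.flow (-1) (Φ.flow 1 y) = y
  rw [Φ.flow_add, neg_add_cancel, Φ.flow_zero]

/-- The retraction of the pull-back on the last fiber. -/
def retraction : C(A.Pullback γ, A.Fiber w) where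
  toFun q := ⟨Φ.flow (1 - q.1.1) q.1.2, by simpa using Φ.flow_mem q.1.1 1 q.1.2 q.2⟩
  continuous_toFun := by
    refine Continuous.subtype_mk (Φ.continuous_flow.comp (g := Function.uncurry Φ.flow)
      (f := fun q : A.Pullback γ => ((1 : ℝ) - (q.1.1 : ℝ), (q.1.2 : ℂ))) ?_) _
    fun_prop

/-- The deformation of the pull-back on the last fiber. -/
def deformation : C(A.Pullback γ × I, A.Pullback γ) where
  -- The new base parameter is `1 - (1 - t) (1 - s)`: it moves from `t` to `1` as `s` goes from `0`
  -- to `1`, and is constant over `t = 1`.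
  toFun q := ⟨(unitInterval.symm (unitInterval.symm q.1.1.1 * unitInterval.symm q.2),
    Φ.flow (unitInterval.symm (unitInterval.symm q.1.1.1 * unitInterval.symm q.2) - q.1.1.1)
      q.1.1.2), Φ.flow_mem _ _ _ q.1.2⟩
  continuous_toFun := by
    refine Continuous.subtype_mk (Continuous.prodMk (by fun_prop)
      (Φ.continuous_flow.comp (g := Function.uncurry Φ.flow)
        (f := fun q : A.Pullback γ × I => (((unitInterval.symm (unitInterval.symm q.1.1.1 *
          unitInterval.symm q.2) : I) : ℝ) - (q.1.1.1 : ℝ), (q.1.1.2 : ℂ))) ?_)) _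
    fun_prop

/-- The homotopy, along the flow, from the first fiber to the last one. -/
def sweep : C(A.Fiber z × I, A.Pullback γ) where
  toFun q := ⟨(q.2, Φ.flow q.2 q.1.1), by
    simpa [Pullback, Fiber] using Φ.flow_mem 0 q.2 q.1.1 (by simp)⟩
  continuous_toFun := by
    refine Continuous.subtype_mk (Continuous.prodMk (by fun_prop)
      (Φ.continuous_flow.comp (g := Function.uncurry Φ.flow)
        (f := fun q : A.Fiber z × I => ((q.2 : ℝ), (q.1.1 : ℂ))) ?_)) _
    fun_prop

theorem endMap_coe (y : A.Fiber z) : (Φ.endMap y : ℂ) = Φ.flow 1 y := rfl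

theorem retraction_coe (q : A.Pullback γ) :
    (Φ.retraction q : ℂ) = Φ.flow (1 - q.1.1) q.1.2 := rfl

theorem sweep_coe (q : A.Fiber z × I) : (Φ.sweep q : I × ℂ) = (q.2, Φ.flow q.2 q.1.1) := rfl

theorem inclTarget_coe (y : A.Fiber w) : (A.inclTarget γ y : I × ℂ) = (1, (y : ℂ)) := rfl

variable (L : RankOneLocalSystem ℂ A.compl)

theorem inclTarget_stalkMap : StalkMap (A.fiberSystem L w) (L.comap (A.pullbackMap γ))
    (A.inclTarget γ) 1 :=
  StalkMap.of_tr_eq fun c => congrArg L.tr <| by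
    ext t <;> simp [fiberIncl, pullbackMap, inclTarget]

theorem inclTargetH₁_eq : inclTargetH₁ γ L = twMap (inclTarget_stalkMap (γ := γ) L) :=
  H₁map_eq_twMap _ _ _ _

theorem inclSource_stalkMap : StalkMap (A.fiberSystem L z) (L.comap (A.pullbackMap γ))
    (A.inclSource γ) 1 :=
  StalkMap.of_tr_eq fun c => congrArg L.tr <| by
    ext t <;> simp [fiberIncl, pullbackMap, inclSource]

theorem inclSourceH₁_eq : inclSourceH₁ γ L = twMap (inclSource_stalkMap (γ := γ) L) :=
  H₁map_eq_twMap _ _ _ _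

theorem id_stalkMap : StalkMap (L.comap (A.pullbackMap γ)) (L.comap (A.pullbackMap γ))
    (ContinuousMap.id _) 1 := StalkMap.of_tr_eq fun _ => rfl

theorem deformation_zero (q : A.Pullback γ) : Φ.deformation (q, 0) = ContinuousMap.id _ q := by
  apply Subtype.ext
  apply Prod.ext
  · simp [deformation]
  · simp [deformation, Φ.flow_zero]

theorem deformation_one (q : A.Pullback γ) :
    Φ.deformation (q, 1) = ((A.inclTarget γ).comp Φ.retraction) q := by
  apply Subtype.ext
  apply Prod.ext
  · simp [deformation, inclTarget]
  · simp [deformation, inclTarget_coe, retraction_coe]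

/-- The homotopy formula compares the identity with `inclTarget ∘ retraction`, and `inclTarget` does
not change transports. -/
theorem retraction_stalkMap : StalkMap (L.comap (A.pullbackMap γ)) (A.fiberSystem L w)
    Φ.retraction fun q => (L.comap (A.pullbackMap γ)).tr (trackCurve Φ.deformation q) := fun c => by
  have h := (id_stalkMap (γ := γ) L).homotopy Φ.deformation Φ.deformation_zero Φ.deformation_one c
  have h' := inclTarget_stalkMap (γ := γ) L (Φ.retraction.comp c)
  rw [Pi.one_apply, Pi.one_apply, mul_one, one_mul] at h'
  rw [h, h']
  rfl

/-- The retraction along the flow gives the inverse: it is the identity on the last fiber, whose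
points do not move, and `deformation` links the other composite to the identity. -/
theorem inclTargetH₁_bijective (Φ : A.TransportFlow γ) : Function.Bijective (inclTargetH₁ γ L) := by
  rw [inclTargetH₁_eq]
  refine Function.bijective_iff_has_inverse.2
    ⟨twMap (Φ.retraction_stalkMap L), fun v => ?_, fun v => ?_⟩
  · rw [← LinearMap.comp_apply, twMap_comp, twMap_eq_id, LinearMap.id_apply]
    · intro y
      apply Subtype.ext
      simp [retraction_coe, inclTarget_coe, Φ.flow_zero]
    · intro y
      rw [Pi.one_apply, one_mul]
      convert (L.comap (A.pullbackMap γ)).pathRep.val_const (A.inclTarget γ y) using 1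
      change (L.comap (A.pullbackMap γ)).tr _ = (L.comap (A.pullbackMap γ)).tr _
      congr 1
      ext t : 1
      apply Subtype.ext
      simp [trackCurve, deformation, inclTarget, Φ.flow_zero]
  · rw [← LinearMap.comp_apply, twMap_comp]
    have h := twMap_homotopy (id_stalkMap (γ := γ) L) Φ.deformation Φ.deformation_zero
      Φ.deformation_one
    rw [twMap_congr _ ((id_stalkMap (γ := γ) L).homotopy Φ.deformation Φ.deformation_zero
      Φ.deformation_one) rfl (by ext q; simp), ← h, twMap_eq_id, LinearMap.id_apply]
    · exact fun _ => rfl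
    · exact fun _ => rfl

theorem sweep_zero (y : A.Fiber z) : Φ.sweep (y, 0) = A.inclSource γ y := by
  apply Subtype.ext
  simp [sweep_coe, inclSource, Φ.flow_zero]

theorem sweep_one (y : A.Fiber z) : Φ.sweep (y, 1) = ((A.inclTarget γ).comp Φ.endMap) y := by
  apply Subtype.ext
  simp [sweep_coe, inclTarget_coe, endMap_coe]

/-- The change of stalks along the flow lines, normalized by a number. -/
def stalk (a : ℂˣ) (y : A.Fiber z) : ℂˣ :=
  a * (L.comap (A.pullbackMap γ)).tr (trackCurve Φ.sweep y)

theorem endMap_stalkMap (a : ℂˣ) :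
    StalkMap (A.fiberSystem L z) (A.fiberSystem L w) Φ.endMap (Φ.stalk L a) := by
  refine StalkMap.const_mul (fun c => ?_) a
  have h := (inclSource_stalkMap (γ := γ) L).homotopy Φ.sweep Φ.sweep_zero Φ.sweep_one c
  have h' := inclTarget_stalkMap (γ := γ) L (Φ.endMap.comp c)
  rw [Pi.one_apply, Pi.one_apply, mul_one, one_mul] at h'
  rw [h, h']
  rfl

/-- The parallel transport is the map induced by the time one map of a trivializing flow. -/
theorem transport_eq (y₀ : ℂ) (h : ∀ t, (γ t, y₀) ∈ A.compl) :
    transport γ L y₀ h = twMap (Φ.endMap_stalkMap L (L.tr (sectionPath γ y₀ h))⁻¹) := by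
  have hb := Φ.inclTargetH₁_bijective L
  have h1 := Φ.endMap_stalkMap L 1
  -- The sweep along the flow is a homotopy from the first inclusion to the last inclusion composed
  -- with the time one map.
  have key : inclSourceH₁ γ L = inclTargetH₁ γ L ∘ₗ twMap h1 := by
    rw [inclTargetH₁_eq, twMap_comp, inclSourceH₁_eq,
      twMap_homotopy (inclSource_stalkMap (γ := γ) L) Φ.sweep Φ.sweep_zero Φ.sweep_one]
    exact twMap_congr _ _ rfl (by ext y; simp [stalk])
  have h2 : twMap (Φ.endMap_stalkMap L (L.tr (sectionPath γ y₀ h))⁻¹) =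
      (L.tr (sectionPath γ y₀ h))⁻¹ • twMap h1 := by
    rw [← twMap_const_mul]
    exact twMap_congr _ _ rfl (by ext y; simp [stalk])
  rw [transport, dif_pos hb, h2, key]
  congr 1
  refine LinearMap.ext fun v => ?_
  exact (LinearEquiv.ofBijective _ hb).symm_apply_apply _

/-- A base point fixed by the flow sweeps out the section path, and the transport along this path is
the number that is divided out. -/
theorem stalk_base (y₀ : ℂ) (h : ∀ t, (γ t, y₀) ∈ A.compl) (h₀ : y₀ ∈ A.Fiber z)
    (hfix : ∀ s, Φ.flow s y₀ = y₀) :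
    Φ.stalk L (L.tr (sectionPath γ y₀ h))⁻¹ ⟨y₀, h₀⟩ = 1 := by
  rw [stalk, inv_mul_eq_one]
  change _ = L.tr _
  congr 1
  ext t : 1
  apply Subtype.ext
  simp [sectionPath, pullbackMap, trackCurve, sweep_coe, hfix]

theorem transport_bijective (Φ : A.TransportFlow γ) (y₀ : ℂ) (h : ∀ t, (γ t, y₀) ∈ A.compl) :
    Function.Bijective (transport γ L y₀ h) := by
  rw [Φ.transport_eq]
  exact twMap_bijective _ Φ.endMapInv Φ.endMap_comp_inv Φ.endMapInv_comp

end TransportFlow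

end LineArrangement

/-! ### Paths in a subset of the plane -/

namespace PathRep

variable {X G : Type*} [TopologicalSpace X] [Group G]

theorem val_map_eq (R : PathRep X G) {E : Type*} [TopologicalSpace E] [SimplyConnectedSpace E]
    (T : C(E, X)) {p q : E} (c d : Path p q) :
    R.val (T.comp c.toContinuousMap) = R.val (T.comp d.toContinuousMap) :=
  R.val_homotopic _ _ ((SimplyConnectedSpace.paths_homotopic c d).map T)

variable {S : Set ℂ} (R : PathRep S G)

open Classical in
/-- The value on a plane curve, extended by `1` to the curves which are not contained in `S`. -/
def onCurve (f : C(I, ℂ)) : G :=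
  if h : ∀ t, f t ∈ S then R.val ⟨fun t => ⟨f t, h t⟩, by fun_prop⟩ else 1

theorem onCurve_of_mem {f : C(I, ℂ)} (h : ∀ t, f t ∈ S) :
    R.onCurve f = R.val ⟨fun t => ⟨f t, h t⟩, by fun_prop⟩ := dif_pos h

theorem val_eq_onCurve (c : C(I, S)) :
    R.val c = R.onCurve ⟨fun t => (c t : ℂ), by fun_prop⟩ :=
  (R.onCurve_of_mem (f := ⟨fun t => (c t : ℂ), by fun_prop⟩) fun t => (c t).2).symm

/-- The straight-line homotopy stays in `S` and fixes the end points. -/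
theorem onCurve_straight {f g : C(I, ℂ)} (h0 : f 0 = g 0) (h1 : f 1 = g 1)
    (hs : ∀ t, segment ℝ (f t) (g t) ⊆ S) : R.onCurve f = R.onCurve g := by
  have hm : ∀ q : I × I, AffineMap.lineMap (f q.2) (g q.2) (q.1 : ℝ) ∈ S := fun q => by
    refine hs q.2 ?_
    rw [segment_eq_image_lineMap]
    exact ⟨q.1, q.1.2, rfl⟩
  have h := R.val_square ⟨fun q => ⟨AffineMap.lineMap (f q.2) (g q.2) (q.1 : ℝ), hm q⟩, by
    simp only [AffineMap.lineMap_apply_module]; fun_prop⟩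
  rw [R.onCurve_of_mem fun t => hs t (left_mem_segment ℝ _ _),
    R.onCurve_of_mem fun t => hs t (right_mem_segment ℝ _ _)]
  have c0 : R.val (colCurve ⟨fun q => ⟨AffineMap.lineMap (f q.2) (g q.2) (q.1 : ℝ), hm q⟩, by
      simp only [AffineMap.lineMap_apply_module]; fun_prop⟩ 0) = 1 := by
    rw [← R.val_const ⟨f 0, hs 0 (left_mem_segment ℝ _ _)⟩]
    congr 1
    ext t
    simp [colCurve, h0]
  have c1 : R.val (colCurve ⟨fun q => ⟨AffineMap.lineMap (f q.2) (g q.2) (q.1 : ℝ), hm q⟩, by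
      simp only [AffineMap.lineMap_apply_module]; fun_prop⟩ 1) = 1 := by
    rw [← R.val_const ⟨f 1, hs 1 (left_mem_segment ℝ _ _)⟩]
    congr 1
    ext t
    simp [colCurve, h1]
  rw [c0, c1, mul_one, one_mul] at h
  convert h using 2
  · ext t; simp [rowCurve]
  · ext t; simp [rowCurve]

theorem onCurve_trans {a b c : ℂ} (γ : Path a b) (δ : Path b c) (hγ : ∀ t, γ t ∈ S)
    (hδ : ∀ t, δ t ∈ S) : R.onCurve (γ.trans δ).toContinuousMap =
      R.onCurve γ.toContinuousMap * R.onCurve δ.toContinuousMap := by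
  have ha : a ∈ S := by simpa using hγ 0
  have hb : b ∈ S := by simpa using hγ 1
  have hc : c ∈ S := by simpa using hδ 1
  let γ' : Path (⟨a, ha⟩ : S) ⟨b, hb⟩ :=
    { toFun := fun t => ⟨γ t, hγ t⟩
      continuous_toFun := by fun_prop
      source' := by simp
      target' := by simp }
  let δ' : Path (⟨b, hb⟩ : S) ⟨c, hc⟩ :=
    { toFun := fun t => ⟨δ t, hδ t⟩
      continuous_toFun := by fun_prop
      source' := by simp
      target' := by simp }
  have h := R.val_trans γ' δ'
  have e : ∀ t, ((γ'.trans δ') t : ℂ) = (γ.trans δ) t := fun t => by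
    rw [Path.trans_apply, Path.trans_apply]
    split_ifs <;> rfl
  rw [val_eq_onCurve, val_eq_onCurve, val_eq_onCurve] at h
  refine Eq.trans (congrArg R.onCurve ?_) h
  ext t
  exact (e t).symm

theorem onCurve_symm {a b : ℂ} (γ : Path a b) :
    R.onCurve γ.symm.toContinuousMap = (R.onCurve γ.toContinuousMap)⁻¹ := by
  by_cases hγ : ∀ t, γ t ∈ S
  · have ha : a ∈ S := by simpa using hγ 0
    have hb : b ∈ S := by simpa using hγ 1
    let γ' : Path (⟨a, ha⟩ : S) ⟨b, hb⟩ :=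
      { toFun := fun t => ⟨γ t, hγ t⟩
        continuous_toFun := by fun_prop
        source' := by simp
        target' := by simp }
    have h := R.val_symm γ'
    rw [val_eq_onCurve, val_eq_onCurve] at h
    exact h
  · have hγ' : ¬ ∀ t, γ.symm t ∈ S := fun h => hγ fun t => by simpa using h (unitInterval.symm t)
    have e1 : R.onCurve γ.symm.toContinuousMap = 1 := dif_neg hγ'
    have e2 : R.onCurve γ.toContinuousMap = 1 := dif_neg hγ
    rw [e1, e2, inv_one]

/-- The sign of `η` selects a half plane. Away from their common ends both curves lie in it, and it
is convex and contained in `S`. -/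
theorem onCurve_half (hS : ∀ y : ℂ, y.im ≠ 0 → y ∈ S) (η : ℝ) {f g : C(I, ℂ)} (h0 : f 0 = g 0)
    (h1 : f 1 = g 1) (m0 : f 0 ∈ S) (m1 : f 1 ∈ S)
    (hf : ∀ t, t ≠ 0 → t ≠ 1 → 0 < η * (f t).im) (hg : ∀ t, t ≠ 0 → t ≠ 1 → 0 < η * (g t).im) :
    R.onCurve f = R.onCurve g := by
  refine R.onCurve_straight h0 h1 fun t => ?_
  by_cases ht0 : t = 0
  · rw [ht0, ← h0, segment_same, singleton_subset_iff]; exact m0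
  by_cases ht1 : t = 1
  · rw [ht1, ← h1, segment_same, singleton_subset_iff]; exact m1
  rintro _ ⟨a, b, ha, hb, hab, rfl⟩
  refine hS _ fun h => ?_
  have h' : a * (η * (f t).im) + b * (η * (g t).im) = 0 := by
    have : a * (f t).im + b * (g t).im = 0 := by simpa using h
    linear_combination η * this
  have h1 := hf t ht0 ht1
  have h2 := hg t ht0 ht1
  rcases ha.eq_or_lt with rfl | ha
  · simp only [zero_add] at hab; subst hab; linarith
  · have := mul_pos ha h1
    have := mul_nonneg hb h2.le
    linarith

/-- The value on a segment. -/
def seg (a b : ℂ) : G := R.onCurve (Path.segment a b).toContinuousMap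

theorem seg_symm (a b : ℂ) : R.seg b a = (R.seg a b)⁻¹ := by
  rw [seg, seg, ← onCurve_symm]
  congr 1
  ext t
  simp [AffineMap.lineMap_apply_module]

theorem segment_im (a b : ℂ) (t : I) :
    (Path.segment a b t).im = (1 - (t : ℝ)) * a.im + t * b.im := by
  simp [AffineMap.lineMap_apply_module]

theorem segment_im_pos {η : ℝ} {a b : ℂ} (ha : 0 ≤ η * a.im) (hb : 0 < η * b.im) {t : I}
    (ht : t ≠ 0) : 0 < η * (Path.segment a b t).im := by
  have ht0 : (0 : ℝ) < t := unitInterval.pos_iff_ne_zero.2 ht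
  rw [segment_im, mul_add, mul_left_comm, mul_left_comm η]
  have := mul_nonneg (sub_nonneg.2 t.2.2) ha
  have := mul_pos ht0 hb
  linarith

theorem segment_im_pos' {η : ℝ} {a b : ℂ} (ha : 0 < η * a.im) (hb : 0 ≤ η * b.im) {t : I}
    (ht : t ≠ 1) : 0 < η * (Path.segment a b t).im := by
  have ht0 : (t : ℝ) < 1 := unitInterval.lt_one_iff_ne_one.2 ht
  rw [segment_im, mul_add, mul_left_comm, mul_left_comm η]
  have := mul_pos (sub_pos.2 ht0) ha
  have := mul_nonneg t.2.1 hb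
  linarith

theorem trans_segment_im_pos {η : ℝ} {a b h : ℂ} (ha : 0 ≤ η * a.im) (hb : 0 ≤ η * b.im)
    (hh : 0 < η * h.im) {t : I} (ht0 : t ≠ 0) (ht1 : t ≠ 1) :
    0 < η * (((Path.segment a h).trans (Path.segment h b)) t).im := by
  rw [Path.trans_apply]
  split_ifs with ht
  · refine segment_im_pos ha hh fun h => ht0 ?_
    have := congrArg Subtype.val h
    ext
    simpa using this
  · refine segment_im_pos' hh hb fun h => ht1 ?_
    have := congrArg Subtype.val h
    ext
    have h1 : 2 * (t : ℝ) - 1 = 1 := by simpa using this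
    change (t : ℝ) = 1
    linarith

theorem segment_mem_half (hS : ∀ y : ℂ, y.im ≠ 0 → y ∈ S) {η : ℝ} {a b : ℂ} (ha : a ∈ S)
    (ha' : 0 ≤ η * a.im) (hb : 0 < η * b.im) (t : I) : Path.segment a b t ∈ S := by
  by_cases ht : t = 0
  · subst ht; simpa using ha
  · exact hS _ fun h => (segment_im_pos ha' hb ht).ne' (by rw [h, mul_zero])

theorem segment_mem_half' (hS : ∀ y : ℂ, y.im ≠ 0 → y ∈ S) {η : ℝ} {a b : ℂ} (hb : b ∈ S)
    (ha : 0 < η * a.im) (hb' : 0 ≤ η * b.im) (t : I) : Path.segment a b t ∈ S := by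
  by_cases ht : t = 1
  · subst ht; simpa using hb
  · exact hS _ fun h => (segment_im_pos' ha hb' ht).ne' (by rw [h, mul_zero])

/-- In a half plane, the value on a curve only depends on its end points. -/
theorem onCurve_eq_seg_mul_seg (hS : ∀ y : ℂ, y.im ≠ 0 → y ∈ S) {η : ℝ} {h : ℂ}
    (hh : 0 < η * h.im) (f : C(I, ℂ)) (m0 : f 0 ∈ S) (m1 : f 1 ∈ S) (s0 : 0 ≤ η * (f 0).im)
    (s1 : 0 ≤ η * (f 1).im) (hf : ∀ t, t ≠ 0 → t ≠ 1 → 0 < η * (f t).im) :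
    R.onCurve f = R.seg (f 0) h * R.seg h (f 1) := by
  rw [seg, seg, ← R.onCurve_trans _ _ (segment_mem_half hS m0 s0 hh)
    (segment_mem_half' hS m1 hh s1)]
  exact R.onCurve_half hS η (by simp) (by simp) m0 m1 hf
    fun t ht0 ht1 => trans_segment_im_pos s0 s1 hh ht0 ht1

theorem seg_mul_seg (hS : ∀ y : ℂ, y.im ≠ 0 → y ∈ S) {η : ℝ} {a h b : ℂ} (ha : 0 < η * a.im)
    (hh : 0 < η * h.im) (hb : b ∈ S) (hb' : 0 ≤ η * b.im) :
    R.seg a h * R.seg h b = R.seg a b := by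
  have := R.onCurve_eq_seg_mul_seg hS hh (Path.segment a b).toContinuousMap
    (by simpa using hS a fun h => ha.ne' (by rw [h, mul_zero])) (by simpa using hb)
    (by simpa using ha.le) (by simpa using hb') fun t ht0 ht1 => segment_im_pos' ha hb' ht1
  refine Eq.trans ?_ this.symm
  simp

/-! ### Circles -/

/-- The value on the arc of center `c` and radius `r` between two angles. -/
def arc (c : ℂ) (r α β : ℝ) : G :=
  R.onCurve ⟨fun t => c + r * Complex.exp (Path.segment α β t * Complex.I), by fun_prop⟩

theorem arc_mul_arc {c : ℂ} {r : ℝ} (hc : ∀ θ : ℝ, c + r * Complex.exp (θ * Complex.I) ∈ S)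
    (α β γ : ℝ) : R.arc c r α β * R.arc c r β γ = R.arc c r α γ := by
  have h := R.val_segmentCurve
    (T := ⟨fun θ : ℝ => ⟨c + r * Complex.exp (θ * Complex.I), hc θ⟩, by fun_prop⟩) α β γ
  rw [val_eq_onCurve, val_eq_onCurve, val_eq_onCurve] at h
  exact h

theorem arc_im (c r θ : ℝ) :
    ((c : ℂ) + r * Complex.exp (θ * Complex.I)).im = r * Real.sin θ := by
  simp [Complex.exp_ofReal_mul_I_im]

theorem arc_half (hS : ∀ y : ℂ, y.im ≠ 0 → y ∈ S) {c r : ℝ} (hr : 0 < r)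
    (hc : ∀ θ : ℝ, (c : ℂ) + r * Complex.exp (θ * Complex.I) ∈ S) {η α β : ℝ} (hαβ : α < β)
    (hη : ∀ θ ∈ Ioo α β, 0 < η * Real.sin θ) {h : ℂ} (hh : 0 < η * h.im) :
    R.arc c r α β = R.seg (c + r * Complex.exp (α * Complex.I)) h *
      R.seg h (c + r * Complex.exp (β * Complex.I)) := by
  -- The ends of the arc may be real; there only the weak inequality survives, by continuity.
  have hcl : ∀ θ ∈ Icc α β, 0 ≤ η * Real.sin θ := by
    rw [← closure_Ioo hαβ.ne]
    exact fun θ hθ => le_on_closure (fun x hx => (hη x hx).le) continuousOn_const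
      (by fun_prop) hθ
  have := R.onCurve_eq_seg_mul_seg hS hh
    ⟨fun t => (c : ℂ) + r * Complex.exp (Path.segment α β t * Complex.I), by fun_prop⟩
    (hc _) (hc _) ?_ ?_ ?_
  · rw [arc, this]
    simp
  · rw [ContinuousMap.coe_mk, arc_im, mul_left_comm]
    exact mul_nonneg hr.le (hcl _ (by simpa using hαβ.le))
  · rw [ContinuousMap.coe_mk, arc_im, mul_left_comm]
    exact mul_nonneg hr.le (hcl _ (by simpa using hαβ.le))
  · intro t ht0 ht1
    rw [ContinuousMap.coe_mk, arc_im, mul_left_comm]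
    refine mul_pos hr (hη _ ?_)
    have h0 : (0 : ℝ) < t := unitInterval.pos_iff_ne_zero.2 ht0
    have h1 : (t : ℝ) < 1 := unitInterval.lt_one_iff_ne_one.2 ht1
    rw [Path.segment_apply, AffineMap.lineMap_apply_module, smul_eq_mul, smul_eq_mul]
    constructor <;> nlinarith

/-- The value on the path from `b` in the upper half plane, through the real point `g`, to `b'` in
the lower half plane. -/
def gate (b b' : ℂ) (g : ℝ) : G := R.seg b g * R.seg g b'

/-- The circle is cut at its real points `c - r` and `c + r` into arcs lying in half planes. Each
arc is replaced by two segments through `b` or `b'`, and the segments to the starting point cancel.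
-/
theorem circle_eq_gate (hS : ∀ y : ℂ, y.im ≠ 0 → y ∈ S) {c r : ℝ} (hr : 0 < r)
    (hc : ∀ θ : ℝ, (c : ℂ) + r * Complex.exp (θ * Complex.I) ∈ S) {θ : ℝ}
    (hθ : θ ∈ Ioo 0 Real.pi) {b b' : ℂ} (hb : 0 < b.im) (hb' : b'.im < 0) :
    R.seg b (c + r * Complex.exp (θ * Complex.I)) * R.arc c r θ (θ + 2 * Real.pi) *
      R.seg (c + r * Complex.exp (θ * Complex.I)) b =
    R.gate b b' (c - r) * (R.gate b b' (c + r))⁻¹ := by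
  obtain ⟨h1, h2⟩ := hθ
  have a1 := R.arc_half hS hr hc (η := 1) h2 (h := b) (fun x hx => by
    rw [one_mul]; exact Real.sin_pos_of_pos_of_lt_pi (h1.trans hx.1) hx.2) (by simpa using hb)
  have a2 := R.arc_half hS hr hc (η := -1) (α := Real.pi) (β := 2 * Real.pi) (h := b')
    (by linarith) (fun x hx => by
      have := Real.sin_pos_of_pos_of_lt_pi (x := x - Real.pi) (by linarith [hx.1])
        (by linarith [hx.2])
      rw [Real.sin_sub_pi] at this; linarith) (by linarith)
  have a3 := R.arc_half hS hr hc (η := 1) (α := 2 * Real.pi) (β := θ + 2 * Real.pi) (h := b)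
    (by linarith) (fun x hx => by
      have := Real.sin_pos_of_pos_of_lt_pi (x := x - 2 * Real.pi) (by linarith [hx.1])
        (by linarith [hx.2])
      rw [Real.sin_sub_two_pi] at this; linarith) (by simpa using hb)
  have e1 : (c : ℂ) + r * Complex.exp (Real.pi * Complex.I) = ((c - r : ℝ) : ℂ) := by
    rw [Complex.exp_pi_mul_I]; push_cast; ring
  have e2 : (c : ℂ) + r * Complex.exp ((2 * Real.pi : ℝ) * Complex.I) = ((c + r : ℝ) : ℂ) := by
    push_cast; rw [Complex.exp_two_pi_mul_I]; ring
  have e3 : (c : ℂ) + r * Complex.exp ((θ + 2 * Real.pi : ℝ) * Complex.I) =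
      c + r * Complex.exp (θ * Complex.I) := by
    push_cast; rw [add_mul, Complex.exp_add, Complex.exp_two_pi_mul_I, mul_one]
  rw [e1] at a1 a2
  rw [e2] at a2 a3
  rw [e3] at a3
  rw [← R.arc_mul_arc hc θ (2 * Real.pi), ← R.arc_mul_arc hc θ Real.pi, a1, a2, a3, gate, gate,
    R.seg_symm b (c + r * Complex.exp (θ * Complex.I)), R.seg_symm b ((c + r : ℝ) : ℂ),
    R.seg_symm b' ((c + r : ℝ) : ℂ)]
  group

/-- The straight-line homotopy between the two gates consists of the gates at the intermediate real
points. -/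
theorem gate_eq_gate (hS : ∀ y : ℂ, y.im ≠ 0 → y ∈ S) {g g' : ℝ}
    (hg : ∀ x ∈ uIcc g g', (x : ℂ) ∈ S) {b b' : ℂ} (hb : 0 < b.im) (hb' : b'.im < 0) :
    R.gate b b' g = R.gate b b' g' := by
  have hbS : ∀ x : ℝ, (x : ℂ) ∈ S → ∀ t, Path.segment b (x : ℂ) t ∈ S := fun x hx =>
    segment_mem_half' hS (η := 1) hx (by simpa using hb) (by simp)
  have hbS' : ∀ x : ℝ, (x : ℂ) ∈ S → ∀ t, Path.segment (x : ℂ) b' t ∈ S := fun x hx =>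
    segment_mem_half hS (η := -1) hx (by simp) (by linarith)
  have hgS := hg g left_mem_uIcc
  have hgS' := hg g' right_mem_uIcc
  rw [gate, gate, seg, seg, seg, seg, ← R.onCurve_trans _ _ (hbS g hgS) (hbS' g hgS),
    ← R.onCurve_trans _ _ (hbS g' hgS') (hbS' g' hgS')]
  refine R.onCurve_straight (by simp) (by simp) fun t => ?_
  rintro _ ⟨u, v, hu, hv, huv, rfl⟩
  obtain ⟨x, hx, h⟩ : ∃ x ∈ uIcc g g', u • ((Path.segment b (g : ℂ)).trans (Path.segment (g : ℂ) b')) t +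
      v • ((Path.segment b (g' : ℂ)).trans (Path.segment (g' : ℂ) b')) t =
      ((Path.segment b (x : ℂ)).trans (Path.segment (x : ℂ) b')) t := by
    refine ⟨u * g + v * g', ?_, ?_⟩
    · rw [← segment_eq_uIcc]
      exact ⟨u, v, hu, hv, huv, rfl⟩
    · rw [Path.trans_apply, Path.trans_apply, Path.trans_apply]
      have hv' : (v : ℂ) = 1 - u := by rw [← Complex.ofReal_one, ← huv]; push_cast; ring
      split_ifs <;>
      · simp only [Path.segment_apply, AffineMap.lineMap_apply_module, Complex.real_smul]
        push_cast
        rw [hv']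
        ring
  change u • ((Path.segment b (g : ℂ)).trans (Path.segment (g : ℂ) b')) t +
      v • ((Path.segment b (g' : ℂ)).trans (Path.segment (g' : ℂ) b')) t ∈ S
  rw [h, Path.trans_apply]
  split_ifs
  · exact hbS x (hg x hx) _
  · exact hbS' x (hg x hx) _

/-! ### Dehn twists -/

theorem onCurve_comap_of_fixed (φ : C(S, S)) {f : C(I, ℂ)} (hm : ∀ t, f t ∈ S)
    (hf : ∀ t, (φ ⟨f t, hm t⟩ : ℂ) = f t) : (R.comap φ).onCurve f = R.onCurve f := by
  rw [onCurve_of_mem _ hm, onCurve_of_mem _ hm]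
  change R.val _ = R.val _
  congr 1
  ext t
  exact hf t

/-- `φ` is a full positive twist in the annulus with center `c` and radii `ρ₁ < ρ₂`, and the identity
in the small disc and far from the real axis. -/
structure IsTwist (φ : C(S, S)) (c ρ₁ ρ₂ : ℝ) : Prop where
  pos : 0 < ρ₁
  lt : ρ₁ < ρ₂
  mem : ∀ y : ℂ, ‖y - c‖ ∈ Icc ρ₁ ρ₂ → y ∈ S
  far : ∀ y : S, ρ₂ ≤ |(y : ℂ).im| → φ y = y
  near : ∃ χ : ℝ → ℝ, Continuous χ ∧ (∀ r ≤ ρ₁, χ r = 1) ∧ χ ρ₂ = 0 ∧ ∀ y : S, ‖(y : ℂ) - c‖ ≤ ρ₂ →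
    (φ y : ℂ) = c + (y - c) * Complex.exp (2 * Real.pi * χ ‖(y : ℂ) - c‖ * Complex.I)

namespace IsTwist

variable {φ : C(S, S)} {c ρ₁ ρ₂ : ℝ}

theorem id_of_norm_le (h : IsTwist φ c ρ₁ ρ₂) (y : S) (hy : ‖(y : ℂ) - c‖ ≤ ρ₁) : φ y = y := by
  obtain ⟨χ, -, h1, -, h2⟩ := h.near
  apply Subtype.ext
  rw [h2 y (hy.trans h.lt.le), h1 _ hy, Complex.ofReal_one, mul_one, Complex.exp_two_pi_mul_I]
  ring

theorem circle_mem (h : IsTwist φ c ρ₁ ρ₂) {r : ℝ} (hr : r ∈ Icc ρ₁ ρ₂) (θ : ℝ) :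
    (c : ℂ) + r * Complex.exp (θ * Complex.I) ∈ S := by
  refine h.mem _ ?_
  rwa [add_sub_cancel_left, norm_mul, Complex.norm_exp_ofReal_mul_I, mul_one, Complex.norm_real,
    Real.norm_of_nonneg (h.pos.le.trans hr.1)]

/-- In polar coordinates the image of the radius is a spiral. It is homotopic to one turn of the
outer circle followed by the radius. -/
theorem radial (h : IsTwist φ c ρ₁ ρ₂) (θ : ℝ) :
    (R.comap φ).seg (c + ρ₂ * Complex.exp (θ * Complex.I)) (c + ρ₁ * Complex.exp (θ * Complex.I)) =
      R.arc c ρ₂ θ (θ + 2 * Real.pi) *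
        R.seg (c + ρ₂ * Complex.exp (θ * Complex.I)) (c + ρ₁ * Complex.exp (θ * Complex.I)) := by
  obtain ⟨χ, hχ, h1, h0, h2⟩ := h.near
  -- Clamping the radius makes polar coordinates a map from the whole plane, which is simply
  -- connected, to the annulus.
  have hcl : ∀ r : ℝ, max ρ₁ (min r ρ₂) ∈ Icc ρ₁ ρ₂ := fun r =>
    ⟨le_max_left _ _, max_le h.lt.le (min_le_right _ _)⟩
  have hcl' : ∀ r ∈ Icc ρ₁ ρ₂, max ρ₁ (min r ρ₂) = r := fun r hr => by
    rw [min_eq_left hr.2, max_eq_right hr.1]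
  let T : C(ℝ × ℝ, S) := ⟨fun q => ⟨c + (max ρ₁ (min q.1 ρ₂) : ℝ) * Complex.exp (q.2 * Complex.I),
    h.circle_mem (hcl _) _⟩, by fun_prop⟩
  let r : Path ρ₂ ρ₁ := Path.segment ρ₂ ρ₁
  have hr : ∀ t, r t ∈ Icc ρ₁ ρ₂ := fun t => by
    have := segment_eq_image_lineMap ℝ ρ₂ ρ₁
    rw [segment_symm, segment_eq_Icc h.lt.le] at this
    rw [this]
    exact ⟨t, t.2, rfl⟩
  let spiral : Path (ρ₂, θ) (ρ₁, θ + 2 * Real.pi) :=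
    { toFun := fun t => (r t, θ + 2 * Real.pi * χ (r t))
      continuous_toFun := by fun_prop
      source' := by simp [h0]
      target' := by simp [h1 ρ₁ le_rfl] }
  have key := R.val_map_eq T spiral ((Path.segment (ρ₂, θ) (ρ₂, θ + 2 * Real.pi)).trans
    (Path.segment (ρ₂, θ + 2 * Real.pi) (ρ₁, θ + 2 * Real.pi)))
  have htr := R.val_trans ((Path.segment (ρ₂, θ) (ρ₂, θ + 2 * Real.pi)).map T.continuous)
    ((Path.segment (ρ₂, θ + 2 * Real.pi) (ρ₁, θ + 2 * Real.pi)).map T.continuous)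
  rw [← Path.map_trans] at htr
  have key := key.trans htr
  rw [val_eq_onCurve R (Path.toContinuousMap _), val_eq_onCurve R (Path.toContinuousMap _)] at key
  have hseg : ∀ t, (c : ℂ) + r t * Complex.exp (θ * Complex.I) = Path.segment
      ((c : ℂ) + ρ₂ * Complex.exp (θ * Complex.I)) (c + ρ₁ * Complex.exp (θ * Complex.I)) t := by
    intro t
    simp only [r, Path.segment_apply, AffineMap.lineMap_apply_module, Complex.real_smul, smul_eq_mul]
    push_cast
    ring
  have hm : ∀ t, Path.segment ((c : ℂ) + ρ₂ * Complex.exp (θ * Complex.I))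
      (c + ρ₁ * Complex.exp (θ * Complex.I)) t ∈ S := fun t => by
    rw [← hseg]; exact h.circle_mem (hr t) θ
  have e0 : (R.comap φ).seg (c + ρ₂ * Complex.exp (θ * Complex.I))
      (c + ρ₁ * Complex.exp (θ * Complex.I)) = R.val (T.comp spiral.toContinuousMap) := by
    rw [seg, onCurve_of_mem (R.comap φ) hm]
    change R.val _ = R.val _
    congr 1
    ext t
    have hn : ‖Path.segment ((c : ℂ) + ρ₂ * Complex.exp (θ * Complex.I))
        (c + ρ₁ * Complex.exp (θ * Complex.I)) t - c‖ = r t := by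
      rw [← hseg, add_sub_cancel_left, norm_mul, Complex.norm_exp_ofReal_mul_I, mul_one, Complex.norm_real,
        Real.norm_of_nonneg (h.pos.le.trans (hr t).1)]
    have h3 := h2 ⟨_, hm t⟩ (hn.trans_le (hr t).2)
    change (φ ⟨_, hm t⟩ : ℂ) = (c : ℂ) + (max ρ₁ (min (r t) ρ₂) : ℝ) *
      Complex.exp ((θ + 2 * Real.pi * χ (r t) : ℝ) * Complex.I)
    rw [h3, hcl' _ (hr t)]
    simp only [hn]
    rw [← hseg]
    push_cast
    rw [add_mul, Complex.exp_add]
    ring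
  rw [e0, key, arc, seg]
  congr 2
  · ext t
    change (c : ℂ) + (max ρ₁ (min (Path.segment (ρ₂, θ) (ρ₂, θ + 2 * Real.pi) t).1 ρ₂) : ℝ) *
      Complex.exp ((Path.segment (ρ₂, θ) (ρ₂, θ + 2 * Real.pi) t).2 * Complex.I) =
      c + ρ₂ * Complex.exp ((Path.segment θ (θ + 2 * Real.pi) t : ℝ) * Complex.I)
    have e : Path.segment (ρ₂, θ) (ρ₂, θ + 2 * Real.pi) t =
        (ρ₂, Path.segment θ (θ + 2 * Real.pi) t) := by
      ext <;> simp [AffineMap.lineMap_apply_module]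
      ring
    rw [e, hcl' ρ₂ ⟨h.lt.le, le_rfl⟩]
  · ext t
    change (c : ℂ) + (max ρ₁ (min (Path.segment (ρ₂, θ + 2 * Real.pi) (ρ₁, θ + 2 * Real.pi) t).1
      ρ₂) : ℝ) * Complex.exp ((Path.segment (ρ₂, θ + 2 * Real.pi) (ρ₁, θ + 2 * Real.pi) t).2 *
        Complex.I) = Path.segment ((c : ℂ) + ρ₂ * Complex.exp (θ * Complex.I))
          (c + ρ₁ * Complex.exp (θ * Complex.I)) t
    have e : Path.segment (ρ₂, θ + 2 * Real.pi) (ρ₁, θ + 2 * Real.pi) t =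
        (r t, θ + 2 * Real.pi) := by
      ext <;> simp [AffineMap.lineMap_apply_module, r]
      ring
    rw [e, hcl' _ (hr t), ← hseg]
    push_cast
    rw [add_mul, Complex.exp_add, Complex.exp_two_pi_mul_I, mul_one]

/-- The path from `b` to `g` is deformed to pass through the points of the outer and inner circles
straight above, or below, the center. The first piece is fixed because it is far from the real axis,
the last because it lies in the inner disc; only the radial piece is twisted. -/
theorem seg_comap (hS : ∀ y : ℂ, y.im ≠ 0 → y ∈ S) (h : IsTwist φ c ρ₁ ρ₂) {η θ : ℝ}
    (hη : |η| = 1) (hθ : η * Real.sin θ = 1) {b : ℂ} (hb : ρ₂ ≤ η * b.im) {g : ℝ}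
    (hgS : (g : ℂ) ∈ S) (hg : |g - c| ≤ ρ₁) :
    (R.comap φ).seg b g = R.seg b (c + ρ₂ * Complex.exp (θ * Complex.I)) *
      R.arc c ρ₂ θ (θ + 2 * Real.pi) * R.seg (c + ρ₂ * Complex.exp (θ * Complex.I)) b *
        R.seg b g := by
  have hρ := h.pos.trans h.lt
  have hrad := h.radial (R := R) θ
  have him : ∀ r : ℝ, η * ((c : ℂ) + r * Complex.exp (θ * Complex.I)).im = r := fun r => by
    rw [arc_im, mul_left_comm, hθ, mul_one]
  have hs := him ρ₂
  have hk := him ρ₁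
  have hkn : ‖((c : ℂ) + ρ₁ * Complex.exp (θ * Complex.I)) - c‖ ≤ ρ₁ := by
    rw [add_sub_cancel_left, norm_mul, Complex.norm_exp_ofReal_mul_I, mul_one, Complex.norm_real,
      Real.norm_of_nonneg h.pos.le]
  generalize (c : ℂ) + ρ₂ * Complex.exp (θ * Complex.I) = s at *
  generalize (c : ℂ) + ρ₁ * Complex.exp (θ * Complex.I) = k at *
  have hb0 : 0 < η * b.im := hρ.trans_le hb
  have hs0 : 0 < η * s.im := hs.symm ▸ hρ
  have hk0 : 0 < η * k.im := hk.symm ▸ h.pos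
  have hg0 : 0 ≤ η * (g : ℂ).im := by simp
  have hsS : s ∈ S := hS _ fun h => hs0.ne' (by rw [h, mul_zero])
  have hkS : k ∈ S := hS _ fun h => hk0.ne' (by rw [h, mul_zero])
  have e1 : (R.comap φ).seg b s = R.seg b s := by
    refine R.onCurve_comap_of_fixed φ (segment_mem_half' hS hsS hb0 hs0.le) fun t => ?_
    rw [h.far]
    change ρ₂ ≤ |(Path.segment b s t).im|
    rw [← one_mul |_|, ← hη, ← abs_mul, segment_im]
    refine le_trans ?_ (le_abs_self _)
    have h1 := mul_le_mul_of_nonneg_left hb (sub_nonneg.2 t.2.2)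
    have h2 := mul_le_mul_of_nonneg_left hs.ge t.2.1
    linarith
  have e2 : (R.comap φ).seg k g = R.seg k g := by
    refine R.onCurve_comap_of_fixed φ (segment_mem_half' hS hgS hk0 hg0) fun t => ?_
    rw [h.id_of_norm_le]
    have := (convex_closedBall (c : ℂ) ρ₁).lineMap_mem (x := k) (y := g)
      (by rwa [mem_closedBall_iff_norm])
      (by rwa [mem_closedBall_iff_norm, ← Complex.ofReal_sub, Complex.norm_real]) t.2
    rwa [mem_closedBall_iff_norm] at this
  rw [← (R.comap φ).seg_mul_seg hS hb0 hs0 hgS hg0, ← (R.comap φ).seg_mul_seg hS hs0 hk0 hgS hg0,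
    e1, hrad, e2, mul_assoc _ (R.seg s k), R.seg_mul_seg hS hs0 hk0 hgS hg0, mul_assoc _ (R.seg s b),
    R.seg_mul_seg hS hs0 hb0 hgS hg0]
  group

/-- The twist acts on the loops around the points of the disc as the conjugation by the circle. -/
theorem gate_comap (hS : ∀ y : ℂ, y.im ≠ 0 → y ∈ S) (h : IsTwist φ c ρ₁ ρ₂) {b b' : ℂ}
    (hb : ρ₂ ≤ b.im) (hb' : b'.im ≤ -ρ₂) {g g' : ℝ} (hgS : (g : ℂ) ∈ S) (hgS' : (g' : ℂ) ∈ S)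
    (hg : |g - c| ≤ ρ₁) (hg' : |g' - c| ≤ ρ₁) :
    (R.comap φ).gate b b' g * ((R.comap φ).gate b b' g')⁻¹ =
      R.gate b b' (c - ρ₂) * (R.gate b b' (c + ρ₂))⁻¹ * (R.gate b b' g * (R.gate b b' g')⁻¹) *
        (R.gate b b' (c - ρ₂) * (R.gate b b' (c + ρ₂))⁻¹)⁻¹ := by
  have hρ := h.pos.trans h.lt
  have up := fun (g : ℝ) (hgS : (g : ℂ) ∈ S) (hg : |g - c| ≤ ρ₁) =>
    h.seg_comap (R := R) hS (η := 1) (θ := Real.pi / 2) (by simp) (by simp) (b := b) (by simpa using hb) hgS hg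
  -- The circle seen from `b'` gives a factor independent of `g`, which cancels in the quotient of
  -- two gates; only the circle seen from `b` has to be evaluated.
  have dn := fun (g : ℝ) (hgS : (g : ℂ) ∈ S) (hg : |g - c| ≤ ρ₁) =>
    h.seg_comap (R := R) hS (η := -1) (θ := -(Real.pi / 2)) (by simp) (by simp) (b := b') (by linarith) hgS hg
  have circ := R.circle_eq_gate hS hρ (fun θ => h.circle_mem ⟨h.lt.le, le_rfl⟩ θ)
    (θ := Real.pi / 2) ⟨by linarith [Real.pi_pos], by linarith [Real.pi_pos]⟩ (b := b) (b' := b')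
    (by linarith) (by linarith)
  rw [circ] at up
  have gate' : ∀ (R' : PathRep S G) (g : ℝ), R'.gate b b' g = R'.seg b g * (R'.seg b' g)⁻¹ :=
    fun R' g => by rw [gate, R'.seg_symm b' g]
  rw [gate' (R.comap φ), gate' (R.comap φ), up g hgS hg, up g' hgS' hg', dn g hgS hg,
    dn g' hgS' hg', gate' R g, gate' R g']
  group

end IsTwist

end PathRep

/-! ### Rotation of disjoint discs with real centers -/

/-- A cut-off function, equal to `1` up to `ρ₁` and to `0` from `ρ₂` on. -/
def cutoff (ρ₁ ρ₂ r : ℝ) : ℝ := max 0 (min 1 ((ρ₂ - r) / (ρ₂ - ρ₁)))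

theorem continuous_cutoff (ρ₁ ρ₂ : ℝ) : Continuous (cutoff ρ₁ ρ₂) := by
  unfold cutoff
  fun_prop

theorem cutoff_eq_one {ρ₁ ρ₂ r : ℝ} (h : ρ₁ < ρ₂) (hr : r ≤ ρ₁) : cutoff ρ₁ ρ₂ r = 1 := by
  have h1 : 1 ≤ (ρ₂ - r) / (ρ₂ - ρ₁) := by
    rw [one_le_div (sub_pos.2 h)]
    linarith
  rw [cutoff, min_eq_left h1, max_eq_right zero_le_one]

theorem cutoff_eq_zero {ρ₁ ρ₂ r : ℝ} (h : ρ₁ < ρ₂) (hr : ρ₂ ≤ r) : cutoff ρ₁ ρ₂ r = 0 := by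
  have h1 : (ρ₂ - r) / (ρ₂ - ρ₁) ≤ 0 := div_nonpos_of_nonpos_of_nonneg (by linarith) (by linarith)
  rw [cutoff, min_eq_right (h1.trans zero_le_one), max_eq_left h1]

/-- The flow which rotates the discs of radius `ρ₁` with centers in `C`, with speed `π`, and is the
identity out of the discs of radius `ρ₂`. -/
def discFlow (C : Finset ℝ) (ρ₁ ρ₂ s : ℝ) (y : ℂ) : ℂ :=
  y + ∑ c ∈ C, (y - c) * (Complex.exp ((Real.pi * s * cutoff ρ₁ ρ₂ ‖y - c‖ : ℝ) * Complex.I) - 1)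

section DiscFlow

variable {C : Finset ℝ} {ρ₁ ρ₂ : ℝ}

theorem continuous_discFlow : Continuous fun q : ℝ × ℂ => discFlow C ρ₁ ρ₂ q.1 q.2 := by
  have := continuous_cutoff ρ₁ ρ₂
  unfold discFlow
  fun_prop

theorem discFlow_of_far (hlt : ρ₁ < ρ₂) {y : ℂ} (hy : ∀ c ∈ C, ρ₂ ≤ ‖y - c‖) (s : ℝ) :
    discFlow C ρ₁ ρ₂ s y = y := by
  rw [discFlow, Finset.sum_eq_zero, add_zero]
  intro c hc
  rw [cutoff_eq_zero hlt (hy c hc)]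
  simp

/-- The discs do not overlap, so only the summand of `c` can be nonzero. -/
theorem discFlow_of_near (hlt : ρ₁ < ρ₂)
    (hsep : ∀ c ∈ C, ∀ c' ∈ C, c ≠ c' → 2 * ρ₂ ≤ |c - c'|)
    {y : ℂ} {c : ℝ} (hc : c ∈ C) (hy : ‖y - c‖ ≤ ρ₂) (s : ℝ) :
    discFlow C ρ₁ ρ₂ s y =
      c + (y - c) * Complex.exp ((Real.pi * s * cutoff ρ₁ ρ₂ ‖y - c‖ : ℝ) * Complex.I) := by
  rw [discFlow, Finset.sum_eq_single_of_mem c hc]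
  · ring
  · intro c' hc' hne
    have h1 := hsep c hc c' hc' hne.symm
    have h2 : |c - c'| ≤ ‖y - c‖ + ‖y - c'‖ := by
      rw [← Real.norm_eq_abs, ← Complex.norm_real]
      have h3 : ((c - c' : ℝ) : ℂ) = (y - c') - (y - c) := by push_cast; ring
      rw [h3, add_comm]
      exact norm_sub_le _ _
    rw [cutoff_eq_zero hlt (by linarith)]
    simp

theorem norm_discFlow_sub (hlt : ρ₁ < ρ₂)
    (hsep : ∀ c ∈ C, ∀ c' ∈ C, c ≠ c' → 2 * ρ₂ ≤ |c - c'|)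
    {y : ℂ} {c : ℝ} (hc : c ∈ C) (hy : ‖y - c‖ ≤ ρ₂) (s : ℝ) :
    ‖discFlow C ρ₁ ρ₂ s y - c‖ = ‖y - c‖ := by
  rw [discFlow_of_near hlt hsep hc hy, add_sub_cancel_left, norm_mul,
    Complex.norm_exp_ofReal_mul_I, mul_one]

theorem discFlow_zero (y : ℂ) : discFlow C ρ₁ ρ₂ 0 y = y := by
  simp [discFlow]

/-- The distance to the center is constant along orbits, hence so is the angular speed. -/
theorem discFlow_add (hlt : ρ₁ < ρ₂)
    (hsep : ∀ c ∈ C, ∀ c' ∈ C, c ≠ c' → 2 * ρ₂ ≤ |c - c'|)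
    (s t : ℝ) (y : ℂ) :
    discFlow C ρ₁ ρ₂ s (discFlow C ρ₁ ρ₂ t y) = discFlow C ρ₁ ρ₂ (s + t) y := by
  by_cases h : ∃ c ∈ C, ‖y - c‖ ≤ ρ₂
  · obtain ⟨c, hc, hy⟩ := h
    have hn := norm_discFlow_sub hlt hsep hc hy t
    rw [discFlow_of_near hlt hsep hc (hn.trans_le hy), hn, discFlow_of_near hlt hsep hc hy,
      discFlow_of_near hlt hsep hc hy, add_sub_cancel_left, mul_assoc, ← Complex.exp_add]
    congr 3
    push_cast
    ring
  · push Not at h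
    have h' : ∀ c ∈ C, ρ₂ ≤ ‖y - c‖ := fun c hc => (h c hc).le
    rw [discFlow_of_far hlt h', discFlow_of_far hlt h', discFlow_of_far hlt h']

/-- The flow rotates the discs of radius `ρ₁`. -/
theorem discFlow_rotate (hlt : ρ₁ < ρ₂)
    (hsep : ∀ c ∈ C, ∀ c' ∈ C, c ≠ c' → 2 * ρ₂ ≤ |c - c'|)
    {c a : ℝ} (hc : c ∈ C) (ha : |a| ≤ ρ₁) (s t : ℝ) :
    discFlow C ρ₁ ρ₂ s (c + a * Complex.exp ((Real.pi * t : ℝ) * Complex.I)) =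
      c + a * Complex.exp ((Real.pi * (s + t) : ℝ) * Complex.I) := by
  have hn : ‖(c : ℂ) + a * Complex.exp ((Real.pi * t : ℝ) * Complex.I) - c‖ = |a| := by
    rw [add_sub_cancel_left, norm_mul, Complex.norm_exp_ofReal_mul_I, mul_one, Complex.norm_real,
      Real.norm_eq_abs]
  rw [discFlow_of_near hlt hsep hc (hn.trans_le (ha.trans hlt.le)), hn, cutoff_eq_one hlt ha,
    add_sub_cancel_left, mul_assoc, ← Complex.exp_add]
  congr 3
  push_cast
  ring

end DiscFlow

/-! ### The rotating flow of an arrangement and the full twist of a fiber. -/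

namespace LineArrangement

namespace LocalData

variable {n m : ℕ} {A : LineArrangement n m} {p : ℝ} {hp : (p : ℂ) ∈ A.singProj}
  (D : A.LocalData hp)

/-- Radii for which the flow rotating the discs around the points over `p` trivializes the
arrangement over the circle with center `p` through `x`. -/
structure Radii where
  ρ₁ : ℝ
  ρ₂ : ℝ
  pos : 0 < ρ₁
  lt : ρ₁ < ρ₂
  slope_lt : ∀ i, |A.slope i| * |D.x - p| < ρ₁
  sep : ∀ i j, A.height i p ≠ A.height j p → 2 * ρ₂ ≤ |A.height i p - A.height j p|
  base : ρ₂ ≤ D.y₀.im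

/-- The bound `ε` depends only on the slopes and on the gaps between the heights over `p`; the radii
also depend on the base point. -/
theorem exists_radii (A : LineArrangement n m) {p : ℝ} (hp : (p : ℂ) ∈ A.singProj) :
    ∃ ε > 0, ∀ D : A.LocalData hp, |D.x - p| < ε → Nonempty D.Radii := by
  obtain ⟨i₀⟩ := nonempty_horizontal hp
  obtain ⟨δ, hδ, hsep⟩ : ∃ δ > 0, ∀ i j, A.height i p ≠ A.height j p →
      2 * δ ≤ |A.height i p - A.height j p| := by
    have h : ∀ q : Fin n × Fin n, ∃ δ > 0, A.height q.1 p ≠ A.height q.2 p →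
        2 * δ ≤ |A.height q.1 p - A.height q.2 p| := fun q => by
      by_cases h : A.height q.1 p = A.height q.2 p
      · exact ⟨1, one_pos, fun h' => absurd h h'⟩
      · exact ⟨_, half_pos (abs_pos.2 (sub_ne_zero.2 h)), fun _ => by linarith⟩
    choose δ hδ hδ' using h
    refine ⟨Finset.univ.inf' ⟨(i₀, i₀), Finset.mem_univ _⟩ δ, ?_, fun i j hij => ?_⟩
    · exact (Finset.lt_inf'_iff _).2 fun q _ => hδ q
    · have := Finset.inf'_le δ (Finset.mem_univ (i, j))
      exact (by linarith : _ ≤ 2 * δ (i, j)).trans (hδ' (i, j) hij)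
  set M := Finset.univ.sup' ⟨i₀, Finset.mem_univ _⟩ fun i => |A.slope i| with hM
  have hMi : ∀ i, |A.slope i| ≤ M := fun i => Finset.le_sup' (fun i => |A.slope i|) (Finset.mem_univ i)
  have hM0 : 0 ≤ M := (abs_nonneg _).trans (hMi i₀)
  -- `M + 1` instead of `M`, since all slopes may vanish; this yields `M * |x - p| < δ`.
  refine ⟨δ / (M + 1), by positivity, fun D hD => ?_⟩
  have hx : M * |D.x - p| < min D.y₀.im δ := by
    refine lt_min ?_ ?_
    · obtain ⟨i, -, hi⟩ := Finset.exists_mem_eq_sup' ⟨i₀, Finset.mem_univ _⟩ fun i => |A.slope i|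
      rw [hM, hi]
      exact D.above i
    · rw [lt_div_iff₀ (by positivity)] at hD
      nlinarith [abs_nonneg (D.x - p)]
  have h0 : 0 ≤ M * |D.x - p| := by positivity
  exact ⟨{
    -- Halfway between a bound for the excursion of the lines and the outer radius.
    ρ₁ := (M * |D.x - p| + min D.y₀.im δ) / 2
    ρ₂ := min D.y₀.im δ
    pos := by linarith
    lt := by linarith
    slope_lt := fun i => by
      have := mul_le_mul_of_nonneg_right (hMi i) (abs_nonneg (D.x - p))
      linarith
    sep := fun i j hij => by
      have := min_le_right D.y₀.im δ
      have := hsep i j hij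
      linarith
    base := min_le_left _ _ }⟩

variable (A) in
/-- The points of the horizontal lines over `p`. -/
def centers (p : ℝ) : Finset ℝ := Finset.univ.image fun i => A.height i p

theorem height_mem_centers (i : Fin n) : A.height i p ∈ centers A p :=
  Finset.mem_image_of_mem _ (Finset.mem_univ i)

/-- The equations of the lines centered at `p`, in which turning `z` around `p` turns the marked
points around the heights over `p`. Vertical lines are excluded by `ne_vert`. -/
theorem mem_fiber_iff {z : ℂ} (hz : ‖z - p‖ = |D.x - p|) (y : ℂ) :
    y ∈ A.Fiber z ↔ ∀ i, y ≠ A.height i p + A.slope i * (z - p) := by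
  have h : ∀ i, (A.height i p : ℂ) + A.slope i * (z - p) = A.slope i * z + A.icpt i := fun i => by
    rw [height]; push_cast; ring
  simp only [Fiber, compl, mem_compl_iff, mem_iUnion, not_exists, mem_ofPred_eq, h]
  refine ⟨fun hy i => hy (.inl i), fun hy k => ?_⟩
  rcases k with i | j
  · exact hy i
  · exact D.ne_vert hz j

theorem halfCircle_apply (t : I) : halfCircle D.symmetric t =
    p + (D.x - p) * Complex.exp ((Real.pi * t : ℝ) * Complex.I) := by
  change (p : ℂ) + (D.x - p) * Complex.exp (Real.pi * (t : ℝ) * Complex.I) = _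
  push_cast
  rfl

theorem norm_halfCircle_sub (t : I) : ‖halfCircle D.symmetric t - p‖ = |D.x - p| := by
  rw [halfCircle_apply, add_sub_cancel_left, norm_mul, Complex.norm_exp_ofReal_mul_I, mul_one,
    ← Complex.ofReal_sub, Complex.norm_real, Real.norm_eq_abs]

namespace Radii

variable {D} (ρ : D.Radii)

theorem sep_centers : ∀ c ∈ centers A p, ∀ c' ∈ centers A p, c ≠ c' → 2 * ρ.ρ₂ ≤ |c - c'| := by
  intro c hc c' hc'
  obtain ⟨i, -, rfl⟩ := Finset.mem_image.1 hc
  obtain ⟨j, -, rfl⟩ := Finset.mem_image.1 hc'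
  exact ρ.sep i j

/-- The same radii for the symmetric point. -/
def swap : D.swap.Radii where
  ρ₁ := ρ.ρ₁
  ρ₂ := ρ.ρ₂
  pos := ρ.pos
  lt := ρ.lt
  slope_lt := by
    have h : D.swap.x - p = -(D.x - p) := by
      change D.x' - p = _
      linarith [D.symmetric]
    rw [h, abs_neg]
    exact ρ.slope_lt
  sep := ρ.sep
  base := ρ.base

/-- The rotation of the discs around the points over `p`. -/
def flow (s : ℝ) (y : ℂ) : ℂ := discFlow (centers A p) ρ.ρ₁ ρ.ρ₂ s y

theorem flow_add (s t : ℝ) (y : ℂ) : ρ.flow s (ρ.flow t y) = ρ.flow (s + t) y :=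
  discFlow_add ρ.lt ρ.sep_centers s t y

theorem flow_of_im {y : ℂ} (hy : ρ.ρ₂ ≤ |y.im|) (s : ℝ) : ρ.flow s y = y :=
  discFlow_of_far ρ.lt (fun c _ => hy.trans (by simpa using Complex.abs_im_le_norm (y - c))) s

theorem flow_base (s : ℝ) : ρ.flow s D.y₀ = D.y₀ :=
  ρ.flow_of_im (ρ.base.trans (le_abs_self _)) s

/-- The flow trivializes the bundle over the half circle. -/
def transportFlow : A.TransportFlow (halfCircle D.symmetric) where
  flow := ρ.flow
  continuous_flow := continuous_discFlow
  flow_zero := discFlow_zero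
  flow_add := ρ.flow_add
  flow_mem t t' y hy := by
    rw [D.mem_fiber_iff (D.norm_halfCircle_sub _)] at hy ⊢
    rintro i hi
    -- Were the image on line `i` at time `t'`, flowing by `t - t'` would bring it back to `y`,
    -- which would lie on line `i` at time `t`.
    refine hy i ?_
    have ha : |A.slope i * (D.x - p)| ≤ ρ.ρ₁ := by rw [abs_mul]; exact (ρ.slope_lt i).le
    have h := discFlow_rotate ρ.lt ρ.sep_centers (height_mem_centers i) ha (t - t') t'
    have e : ∀ t : I, (A.slope i : ℂ) * (halfCircle D.symmetric t - p) =
        (A.slope i * (D.x - p) : ℝ) * Complex.exp ((Real.pi * t : ℝ) * Complex.I) := fun t => by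
      rw [halfCircle_apply, add_sub_cancel_left]; push_cast; ring
    rw [e, ← sub_add_cancel (t : ℝ) (t' : ℝ), ← h, ← e, ← hi]
    change _ = ρ.flow _ _
    rw [flow_add, sub_add_sub_cancel, sub_self]
    exact (discFlow_zero y).symm

/-- The full rotation of the discs, as a self-map of the fiber. -/
def twist : C(A.Fiber D.x, A.Fiber D.x) :=
  ContinuousMap.comp (ρ.swap.transportFlow.endMap : C(A.Fiber D.x', A.Fiber D.x))
    ρ.transportFlow.endMap

theorem twist_coe (y : A.Fiber D.x) : (ρ.twist y : ℂ) = ρ.flow 2 y := by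
  change ρ.flow 1 (ρ.flow 1 y) = _
  rw [flow_add]
  norm_num

theorem monodromy_bijective (ρ : D.Radii) (L : RankOneLocalSystem ℂ A.compl) :
    Function.Bijective (D.monodromy L) := by
  have h := (TransportFlow.transport_bijective L ρ.swap.transportFlow D.swap.y₀
    D.swap.section_mem).comp
      (TransportFlow.transport_bijective L ρ.transportFlow D.y₀ D.section_mem)
  exact h

theorem base_mem : D.y₀ ∈ A.Fiber D.x := D.mem_fiber fun _ => D.y₀_ne_real _

/-- The local monodromy is induced by the full rotation of the discs. -/
theorem exists_monodromy_eq (ρ : D.Radii) (L : RankOneLocalSystem ℂ A.compl) :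
    ∃ (u : A.Fiber D.x → ℂˣ) (h : StalkMap (A.fiberSystem L D.x) (A.fiberSystem L D.x) ρ.twist u),
      u ⟨D.y₀, base_mem⟩ = 1 ∧ D.monodromy L = twMap h := by
  have h1 := ρ.transportFlow.transport_eq L D.y₀ D.section_mem
  have h2 := ρ.swap.transportFlow.transport_eq L D.swap.y₀ D.swap.section_mem
  have e : ρ.transportFlow.endMap ⟨D.y₀, base_mem⟩ = ⟨D.swap.y₀, base_mem (D := D.swap)⟩ :=
    Subtype.ext (ρ.flow_base 1)
  have e1 := ρ.transportFlow.stalk_base L D.y₀ D.section_mem base_mem ρ.flow_base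
  have e2 := ρ.swap.transportFlow.stalk_base L D.swap.y₀ D.swap.section_mem
    (base_mem (D := D.swap)) ρ.swap.flow_base
  have s1 := ρ.transportFlow.endMap_stalkMap L
    (L.tr (sectionPath (halfCircle D.symmetric) D.y₀ D.section_mem))⁻¹
  have s2 := ρ.swap.transportFlow.endMap_stalkMap L
    (L.tr (sectionPath (halfCircle D.swap.symmetric) D.swap.y₀ D.swap.section_mem))⁻¹
  refine ⟨_, s1.comp s2, ?_, ?_⟩
  · rw [e, e1, one_mul]
    exact e2
  · refine Eq.trans ?_ (twMap_comp s1 s2)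
    exact congrArg₂ (· ∘ₗ ·) h2 h1

theorem isTwist (k : Fin n) : PathRep.IsTwist ρ.twist (A.height k p) ρ.ρ₁ ρ.ρ₂ where
  pos := ρ.pos
  lt := ρ.lt
  mem y hy := by
    have hz : ‖(D.x : ℂ) - p‖ = |D.x - p| := by
      rw [← Complex.ofReal_sub, Complex.norm_real, Real.norm_eq_abs]
    rw [D.mem_fiber_iff hz]
    rintro i rfl
    have hs := ρ.slope_lt i
    rw [← abs_mul, ← Real.norm_eq_abs, ← Complex.norm_real] at hs
    push_cast at hs
    -- Points of the same block stay inside the inner circle; the others are at distance more than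
    -- `2 * ρ₂ - ρ₁ > ρ₂` from the center.
    by_cases h : A.height i p = A.height k p
    · rw [h, add_sub_cancel_left] at hy
      exact hs.not_ge hy.1
    · have h1 := ρ.sep i k h
      rw [← Real.norm_eq_abs, ← Complex.norm_real] at h1
      have h2 : ((A.height i p - A.height k p : ℝ) : ℂ) =
          (A.height i p + A.slope i * (D.x - p) - A.height k p) - A.slope i * (D.x - p) := by
        push_cast; ring
      rw [h2] at h1
      have h3 := norm_sub_le (A.height i p + A.slope i * (D.x - p) - A.height k p : ℂ)
        (A.slope i * (D.x - p))
      have := ρ.lt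
      linarith [hy.2]
  far y hy := Subtype.ext (by rw [twist_coe, ρ.flow_of_im hy])
  near := by
    refine ⟨cutoff ρ.ρ₁ ρ.ρ₂, continuous_cutoff _ _, fun r hr => cutoff_eq_one ρ.lt hr,
      cutoff_eq_zero ρ.lt le_rfl, fun y hy => ?_⟩
    rw [twist_coe, flow, discFlow_of_near ρ.lt ρ.sep_centers (height_mem_centers k) hy]
    congr 3
    push_cast
    ring

end Radii

end LocalData

end LineArrangement

/-! ### Products of affine maps with known fixed points. -/

namespace TwistedHomology

namespace AffineElement

variable {K V : Type*} [Field K] [AddCommGroup V] [Module K V]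

/-- Linear parts commute, so the conjugate has the linear part of `b`, and the two copies of `a`
contribute `a.shift` and `-b.mult • a.shift`. -/
theorem shift_conj (a b : AffineElement K V) :
    (a * b * a⁻¹).shift = (1 - (b.mult : K)) • a.shift + a.mult • b.shift := by
  simp only [shift_mul, mult_mul, shift_inv, smul_neg, smul_smul, Units.smul_def, Units.val_mul,
    sub_smul, one_smul]
  rw [mul_comm (a.mult : K), mul_assoc, Units.mul_inv, mul_one]
  abel

variable {n : ℕ} {e : Fin n → V} {P : Fin n → Fin n → AffineElement K V}

/-- `P a b` models the product of the elementary loops from `a` to `b`, and `P k k` the single loop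
`α_k`. -/
theorem mult_eq_prod (hP : ∀ a i i' b : Fin n, (i : ℕ) + 1 = i' → P a i * P i' b = P a b)
    {a b : Fin n} (hab : a ≤ b) :
    ((P a b).mult : K) = ∏ k ∈ Finset.Icc a b, ((P k k).mult : K) := by
  obtain ⟨d, hd⟩ := Nat.exists_eq_add_of_le (Fin.le_def.1 hab)
  induction d generalizing b with
  | zero =>
    obtain rfl : a = b := Fin.ext (by omega)
    simp
  | succ d ih =>
    let i : Fin n := ⟨a + d, by omega⟩
    have hi : (i : ℕ) + 1 = b := by simp only [i]; omega
    have hI : Finset.Icc a b = insert b (Finset.Icc a i) := by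
      ext k
      simp only [Finset.mem_Icc, Finset.mem_insert, Fin.le_def, Fin.ext_iff]
      omega
    rw [← hP a i b b hi, mult_mul, Units.val_mul, ih (b := i) (Fin.le_def.2 (by simp [i])) rfl, hI,
      Finset.prod_insert (by simp only [Finset.mem_Icc, Fin.le_def]; omega), mul_comm]

/-- The left side is the affine map `P a i` applied to `e i`, and `h₁` says that `P k k` fixes `e
k`. With `j` the predecessor of `i`, the last factor can be dropped: `P a i (e i) = P a j (e i) = P
a j (e j) - mult (P a j) • (e j - e i)`, and induction applies. -/
theorem shift_add_mult_smul_last (h₁ : ∀ k, (P k k).shift = (1 - ((P k k).mult : K)) • e k)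
    (hP : ∀ a i i' b : Fin n, (i : ℕ) + 1 = i' → P a i * P i' b = P a b)
    {a i : Fin n} (hai : a ≤ i) :
    (P a i).shift + ((P a i).mult : K) • e i = e i + ∑ k ∈ Finset.Ico a i,
      (1 - ∏ l ∈ Finset.Icc a k, ((P l l).mult : K)) • (e k - e (Order.succ k)) := by
  obtain ⟨d, hd⟩ := Nat.exists_eq_add_of_le (Fin.le_def.1 hai)
  induction d generalizing i with
  | zero =>
    obtain rfl : a = i := Fin.ext (by omega)
    rw [h₁, Finset.Ico_self, Finset.sum_empty, ← add_smul, sub_add_cancel, one_smul, add_zero]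
  | succ d ih =>
    let j : Fin n := ⟨a + d, by omega⟩
    have hj : (j : ℕ) + 1 = i := by simp only [j]; omega
    have haj : a ≤ j := Fin.le_def.2 (by simp [j])
    have hs : Order.succ j = i := CovBy.succ_eq ⟨Fin.lt_def.2 (by omega), fun k h h' => by
      rw [Fin.lt_def] at h h'; omega⟩
    have hI : Finset.Ico a i = insert j (Finset.Ico a j) := by
      ext k
      simp only [Finset.mem_Ico, Finset.mem_insert, Fin.le_def, Fin.lt_def, Fin.ext_iff]
      omega
    have ih := ih haj rfl
    rw [hI, Finset.sum_insert (by simp), hs, ← mult_eq_prod hP haj, ← hP a j i i hj, shift_mul,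
      mult_mul, h₁ i, Units.val_mul, Units.smul_def]
    linear_combination (norm := module) ih

/-- Here the factor fixing `e j` is applied last. With `i` the successor of `j`, `P i b (e j) = P i
b (e i) + mult (P i b) • (e j - e i)`. Applying `P j j` then contracts everything towards its fixed
point by the ratio `s_j`, whence the extra products over `Ico j k`. -/
theorem shift_add_mult_smul_first (h₁ : ∀ k, (P k k).shift = (1 - ((P k k).mult : K)) • e k)
    (hP : ∀ a i i' b : Fin n, (i : ℕ) + 1 = i' → P a i * P i' b = P a b)
    {j b : Fin n} (hjb : j ≤ b) :
    (P j b).shift + ((P j b).mult : K) • e j = e j - ∑ k ∈ Finset.Ioc j b,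
      ((∏ l ∈ Finset.Ico j k, ((P l l).mult : K)) *
        (1 - ∏ l ∈ Finset.Icc k b, ((P l l).mult : K))) • (e (Order.pred k) - e k) := by
  obtain ⟨d, hd⟩ := Nat.exists_eq_add_of_le (Fin.le_def.1 hjb)
  induction d generalizing j with
  | zero =>
    obtain rfl : j = b := Fin.ext (by omega)
    rw [h₁, Finset.Ioc_self, Finset.sum_empty, ← add_smul, sub_add_cancel, one_smul, sub_zero]
  | succ d ih =>
    let i : Fin n := ⟨j + 1, by omega⟩
    have hi : (j : ℕ) + 1 = i := rfl
    have hib : i ≤ b := Fin.le_def.2 (by simp only [i]; omega)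
    have hs : Order.pred i = j := CovBy.pred_eq ⟨Fin.lt_def.2 (by omega), fun k h h' => by
      rw [Fin.lt_def] at h h'; omega⟩
    have hI : Finset.Ioc j b = insert i (Finset.Ioc i b) := by
      ext k
      simp only [Finset.mem_Ioc, Finset.mem_insert, Fin.le_def, Fin.lt_def, Fin.ext_iff]
      omega
    have ih := ih hib (by simp only [i]; omega)
    have hJ : Finset.Ico j i = {j} := by
      ext k
      simp only [Finset.mem_Ico, Finset.mem_singleton, Fin.le_def, Fin.lt_def, Fin.ext_iff]
      omega
    have hsum : ∑ k ∈ Finset.Ioc i b, ((∏ l ∈ Finset.Ico j k, ((P l l).mult : K)) *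
        (1 - ∏ l ∈ Finset.Icc k b, ((P l l).mult : K))) • (e (Order.pred k) - e k) =
        ((P j j).mult : K) • ∑ k ∈ Finset.Ioc i b, ((∏ l ∈ Finset.Ico i k, ((P l l).mult : K)) *
        (1 - ∏ l ∈ Finset.Icc k b, ((P l l).mult : K))) • (e (Order.pred k) - e k) := by
      rw [Finset.smul_sum]
      refine Finset.sum_congr rfl fun k hk => ?_
      have hik := Fin.lt_def.1 (Finset.mem_Ioc.1 hk).1
      have hK : Finset.Ico j k = insert j (Finset.Ico i k) := by
        ext l
        simp only [Finset.mem_Ico, Finset.mem_insert, Fin.le_def, Fin.lt_def, Fin.ext_iff]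
        omega
      rw [hK, Finset.prod_insert (by simp only [Finset.mem_Ico, Fin.le_def]; omega), smul_smul,
        mul_assoc]
    rw [hI, Finset.sum_insert (by simp), hs, hJ, Finset.prod_singleton, hsum,
      ← mult_eq_prod hP hib, ← hP j j i b hi, shift_mul, mult_mul, h₁ j, Units.val_mul,
      Units.smul_def]
    linear_combination (norm := module) ((P j j).mult : K) • ih

end AffineElement

end TwistedHomology

/-! ### Elementary loops, gates and blocks in the fiber over `x`. -/

namespace LineArrangement

namespace LocalData

variable {n m : ℕ} {A : LineArrangement n m} {p : ℝ} {hp : (p : ℂ) ∈ A.singProj}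
  (D : A.LocalData hp)

/-- Two lines meeting over `x` would put `x` itself in `π(S)`, against the strict inequality in
`near`. -/
theorem height_injective : Function.Injective fun i => A.height i D.x := by
  intro i j hij
  by_contra hne
  have hx : (D.x : ℂ) ∈ A.singProj := by
    refine ⟨(D.x, A.height i D.x), ⟨.inl i, .inl j, by simpa using hne, ?_, ?_⟩, rfl⟩
    · simp [line, height]
    · rw [show A.height i D.x = A.height j D.x from hij]
      simp [line, height]
  have := D.near _ hx fun h => D.ne (by exact_mod_cast h)
  rw [← Complex.ofReal_sub, Complex.norm_real, Real.norm_eq_abs] at this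
  exact this.false

theorem pt_strictMono : StrictMono (A.pt D.x) :=
  (Tuple.monotone_sort fun i => A.height i D.x).strictMono_of_injective
    (D.height_injective.comp (A.order D.x).injective)

/-- The point over `p` of the `k`-th line. -/
def center (k : Fin n) : ℝ := A.height (A.order D.x k) p

theorem mem_block {i j : Fin n} : j ∈ D.block i ↔ D.center j = D.center i := by
  simp [block, center]

theorem mem_fiber_of_im (y : ℂ) (hy : y.im ≠ 0) : y ∈ A.Fiber D.x :=
  D.mem_fiber fun k h => hy (by rw [h, Complex.ofReal_im])

theorem radius_lt_abs {k l : Fin n} (h : l ≠ k) : D.radius k < |A.pt D.x l - A.pt D.x k| := by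
  have := D.radius_lt k (mem_insert_of_mem _ ⟨l, rfl⟩) (q := A.pt D.x l)
    fun h' => h (D.pt_strictMono.injective (Complex.ofReal_injective h'))
  rwa [← Complex.ofReal_sub, Complex.norm_real] at this

section PathRep

variable {G : Type*} [Group G] (R : PathRep (A.Fiber D.x) G)

/-- The value on a path from `y₀` to its conjugate which crosses the real axis at `g`. -/
def gate (g : ℝ) : G := R.gate D.y₀ (starRingEnd ℂ D.y₀) g

theorem conj_im_neg : (starRingEnd ℂ D.y₀).im < 0 := by
  rw [Complex.conj_im]
  linarith [D.y₀_im_pos]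

/-- No marked point lies between the two crossings. -/
theorem gate_eq {g g' : ℝ} (h : ∀ l, A.pt D.x l < g ∧ A.pt D.x l < g' ∨
    g < A.pt D.x l ∧ g' < A.pt D.x l) : D.gate R g = D.gate R g' := by
  refine R.gate_eq_gate D.mem_fiber_of_im (fun x hx => D.mem_fiber fun l hl => ?_) D.y₀_im_pos
    D.conj_im_neg
  have hl : x = A.pt D.x l := by exact_mod_cast hl
  rw [mem_uIcc] at hx
  rcases h l with ⟨h1, h2⟩ | ⟨h1, h2⟩ <;> rcases hx with hx | hx <;> linarith [hx.1, hx.2]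

/-- The value on the `k`-th elementary loop, in terms of the two gates next to the `k`-th point. -/
theorem val_loop (k : Fin n) : R.val (D.loop k) =
    D.gate R (A.pt D.x k - D.radius k) * (D.gate R (A.pt D.x k + D.radius k))⁻¹ := by
  have hpos : 0 < ‖D.y₀ - A.pt D.x k‖ := norm_pos_iff.2 (sub_ne_zero.2 (D.y₀_ne_real _))
  have hq : 0 < D.radius k / ‖D.y₀ - A.pt D.x k‖ := div_pos (D.radius_pos k) hpos
  have hn : ‖D.foot k - A.pt D.x k‖ = D.radius k := by
    rw [foot, add_sub_cancel_left, norm_mul, Complex.norm_real, Real.norm_of_nonneg hq.le,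
      div_mul_cancel₀ _ hpos.ne']
  have him : 0 < (D.foot k - A.pt D.x k).im := by
    rw [foot, add_sub_cancel_left, Complex.im_ofReal_mul]
    exact mul_pos hq (by simpa using D.y₀_im_pos)
  -- The foot lies above the level of the marked point, so the small circle starts at an angle
  -- strictly between `0` and `π`.
  set θ := Complex.arg (D.foot k - A.pt D.x k) with hθ
  have hfoot : (A.pt D.x k : ℂ) + D.radius k * Complex.exp (θ * Complex.I) = D.foot k := by
    rw [← hn, hθ, Complex.norm_mul_exp_arg_mul_I, add_sub_cancel]
  have hθ' : θ ∈ Ioo 0 Real.pi := by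
    have h0 : 0 ≤ θ := Complex.arg_nonneg_iff.2 him.le
    refine ⟨h0.lt_of_ne fun h => ?_, (Complex.arg_le_pi _).lt_of_ne fun h => ?_⟩
    · exact him.ne' (Complex.arg_eq_zero_iff.1 h.symm).2
    · exact him.ne' (Complex.arg_eq_pi_iff.1 h).2
  have hcirc : ∀ t : ℝ, (A.pt D.x k : ℂ) + D.radius k * Complex.exp (t * Complex.I) ∈
      A.Fiber D.x := fun t => D.mem_fiber fun l hl => by
    have h1 : |A.pt D.x l - A.pt D.x k| = D.radius k := by
      rw [← Real.norm_eq_abs, ← Complex.norm_real, Complex.ofReal_sub, ← hl, add_sub_cancel_left,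
        norm_mul, Complex.norm_exp_ofReal_mul_I, mul_one, Complex.norm_real,
        Real.norm_of_nonneg (D.radius_pos k).le]
    by_cases h : l = k
    · rw [h, sub_self, abs_zero] at h1
      exact (D.radius_pos k).ne h1
    · exact (D.radius_lt_abs h).ne' h1
  have h := R.circle_eq_gate D.mem_fiber_of_im (D.radius_pos k) hcirc hθ' D.y₀_im_pos D.conj_im_neg
  rw [gate, gate, ← h, hfoot, R.val_eq_onCurve]
  have harc : R.onCurve (D.circle k).toContinuousMap =
      R.arc (A.pt D.x k) (D.radius k) θ (θ + 2 * Real.pi) := by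
    rw [PathRep.arc]
    congr 1
    ext t
    change (A.pt D.x k : ℂ) + (D.foot k - A.pt D.x k) *
      Complex.exp (2 * Real.pi * (t : ℝ) * Complex.I) = _
    rw [← hfoot, add_sub_cancel_left, mul_assoc, ← Complex.exp_add]
    simp only [Path.segment_apply, AffineMap.lineMap_apply_module, ContinuousMap.coe_mk]
    congr 3
    simp
    ring
  have h1 := R.onCurve_trans ((Path.segment D.y₀ (D.foot k)).trans (D.circle k))
    (Path.segment D.y₀ (D.foot k)).symm ?_ fun t => D.segment_mem k _
  · refine h1.trans ?_
    rw [R.onCurve_trans _ _ (D.segment_mem k) (D.circle_mem k), harc, R.onCurve_symm,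
      R.seg_symm D.y₀ (D.foot k)]
    rfl
  · intro t
    have : range ((Path.segment D.y₀ (D.foot k)).trans (D.circle k)) ⊆ A.Fiber D.x := by
      rw [Path.trans_range, union_subset_iff]
      exact ⟨range_subset_iff.2 (D.segment_mem k), range_subset_iff.2 (D.circle_mem k)⟩
    exact this (mem_range_self t)

/-- The value on a path around the points from the `a`-th one to the `b`-th one. -/
def arcProd (a b : Fin n) : G :=
  D.gate R (A.pt D.x a - D.radius a) * (D.gate R (A.pt D.x b + D.radius b))⁻¹

theorem sub_radius_lt {k l : Fin n} (h : k ≤ l) : A.pt D.x k - D.radius k < A.pt D.x l := by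
  have := D.pt_strictMono.monotone h
  linarith [D.radius_pos k]

theorem lt_sub_radius {k l : Fin n} (h : l < k) : A.pt D.x l < A.pt D.x k - D.radius k := by
  have h1 := D.radius_lt_abs h.ne
  rw [abs_of_neg (sub_neg.2 (D.pt_strictMono h))] at h1
  linarith

theorem lt_add_radius {k l : Fin n} (h : l ≤ k) : A.pt D.x l < A.pt D.x k + D.radius k := by
  have := D.pt_strictMono.monotone h
  linarith [D.radius_pos k]

theorem add_radius_lt {k l : Fin n} (h : k < l) : A.pt D.x k + D.radius k < A.pt D.x l := by
  have h1 := D.radius_lt_abs h.ne'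
  rw [abs_of_pos (sub_pos.2 (D.pt_strictMono h))] at h1
  linarith

/-- The gate to the right of a point and the gate to the left of the next one cross the same gap. -/
theorem arcProd_mul (a i i' b : Fin n) (h : (i : ℕ) + 1 = i') :
    D.arcProd R a i * D.arcProd R i' b = D.arcProd R a b := by
  have : D.gate R (A.pt D.x i + D.radius i) = D.gate R (A.pt D.x i' - D.radius i') := by
    refine D.gate_eq R fun l => ?_
    rcases le_or_gt l i with hl | hl
    · exact .inl ⟨D.lt_add_radius hl, D.lt_sub_radius (Fin.lt_def.2 (by
        have := Fin.le_def.1 hl; omega))⟩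
    · exact .inr ⟨D.add_radius_lt hl, D.sub_radius_lt (Fin.le_def.2 (by
        have := Fin.lt_def.1 hl; omega))⟩
  rw [arcProd, arcProd, arcProd, this]
  group

namespace Radii

variable {D} (ρ : D.Radii)

theorem abs_pt_sub_center_lt (ρ : D.Radii) (k : Fin n) : |A.pt D.x k - D.center k| < ρ.ρ₁ := by
  have e : A.pt D.x k - D.center k = A.slope (A.order D.x k) * (D.x - p) := by
    simp only [LineArrangement.pt, center, height]
    ring
  rw [e, abs_mul]
  exact ρ.slope_lt _

theorem sep_center (ρ : D.Radii) {k l : Fin n} (h : D.center k < D.center l) :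
    2 * ρ.ρ₂ ≤ D.center l - D.center k := by
  have : 2 * ρ.ρ₂ ≤ |D.center l - D.center k| := ρ.sep _ _ h.ne'
  rwa [abs_of_pos (sub_pos.2 h)] at this

/-- Each point is within `ρ₁` of its center while distinct centers are `2 * ρ₂` apart, so the order
of the centers cannot contradict that of the points. -/
theorem center_monotone (ρ : D.Radii) : Monotone D.center := by
  intro k l hkl
  by_contra! h
  have h1 := ρ.sep_center h
  have h2 := abs_lt.1 (ρ.abs_pt_sub_center_lt k)
  have h3 := abs_lt.1 (ρ.abs_pt_sub_center_lt l)
  have := D.pt_strictMono.monotone hkl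
  linarith [ρ.lt, h2.1, h3.2]

/-- The value on the circle around the disc which contains the `k`-th point. -/
def blockLoop (k : Fin n) : G :=
  D.gate R (D.center k - ρ.ρ₂) * (D.gate R (D.center k + ρ.ρ₂))⁻¹

/-- The loop is a quotient of two gates inside the inner disc, where the full rotation acts as
conjugation by the outer circle. -/
theorem val_twist_loop (k : Fin n) : R.val (ρ.twist.comp (D.loop k)) =
    ρ.blockLoop R k * R.val (D.loop k) * (ρ.blockLoop R k)⁻¹ := by
  obtain ⟨h1, h2⟩ := abs_lt.1 (ρ.abs_pt_sub_center_lt k)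
  -- The circle of radius `D.radius k` may leave the inner disc; it is shrunk, which does not change
  -- the gaps crossed.
  obtain ⟨r, hr0, hr, hr1, hr2⟩ : ∃ r > 0, r ≤ D.radius k ∧ D.center k - ρ.ρ₁ ≤ A.pt D.x k - r ∧
      A.pt D.x k + r ≤ D.center k + ρ.ρ₁ := by
    refine ⟨min (D.radius k) (min (A.pt D.x k - (D.center k - ρ.ρ₁))
      (D.center k + ρ.ρ₁ - A.pt D.x k)), lt_min (D.radius_pos k) (lt_min (by linarith)
        (by linarith)), min_le_left _ _, ?_, ?_⟩
    · have := (min_le_right (D.radius k) _).trans (min_le_left (A.pt D.x k - (D.center k - ρ.ρ₁))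
        (D.center k + ρ.ρ₁ - A.pt D.x k))
      linarith
    · have := (min_le_right (D.radius k) _).trans (min_le_right (A.pt D.x k - (D.center k - ρ.ρ₁))
        (D.center k + ρ.ρ₁ - A.pt D.x k))
      linarith
  have shrink : ∀ R : PathRep (A.Fiber D.x) G, R.val (D.loop k) =
      D.gate R (A.pt D.x k - r) * (D.gate R (A.pt D.x k + r))⁻¹ := fun R => by
    rw [D.val_loop, D.gate_eq R (g := A.pt D.x k - _) (g' := A.pt D.x k - r),
      D.gate_eq R (g := A.pt D.x k + _) (g' := A.pt D.x k + r)]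
    · intro l
      rcases le_or_gt l k with hl | hl
      · have := D.pt_strictMono.monotone hl
        exact .inl ⟨D.lt_add_radius hl, by linarith⟩
      · have := D.add_radius_lt hl
        exact .inr ⟨this, by linarith⟩
    · intro l
      rcases lt_or_ge l k with hl | hl
      · have := D.lt_sub_radius hl
        exact .inl ⟨this, by linarith⟩
      · have := D.pt_strictMono.monotone hl
        exact .inr ⟨D.sub_radius_lt hl, by linarith⟩
  have hmem : ∀ g : ℝ, |g - A.pt D.x k| = r → (g : ℂ) ∈ A.Fiber D.x := fun g hg => by
    refine D.mem_fiber fun l hl => ?_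
    have hl : g = A.pt D.x l := by exact_mod_cast hl
    subst hl
    by_cases h : l = k
    · rw [h, sub_self, abs_zero] at hg
      exact hr0.ne hg
    · linarith [D.radius_lt_abs h]
  have hmem1 := hmem (A.pt D.x k - r) (by rw [sub_sub_cancel_left, abs_neg, abs_of_pos hr0])
  have hmem2 := hmem (A.pt D.x k + r) (by rw [add_sub_cancel_left, abs_of_pos hr0])
  have hconj : (starRingEnd ℂ D.y₀).im ≤ -ρ.ρ₂ := by
    rw [Complex.conj_im]
    linarith [ρ.base]
  have key := (ρ.isTwist (A.order D.x k)).gate_comap (R := R) D.mem_fiber_of_im ρ.base hconj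
    hmem1 hmem2 (abs_le.2 ⟨by change _ ≤ _ - D.center k; linarith,
      by change _ - D.center k ≤ _; linarith⟩)
    (abs_le.2 ⟨by change _ ≤ _ - D.center k; linarith, by change _ - D.center k ≤ _; linarith⟩)
  change (R.comap ρ.twist).val (D.loop k) = _
  rw [shrink, shrink R]
  exact key

/-- The outer circle crosses the real axis in the gaps just before the first and just after the last
point of the block. -/
theorem blockLoop_eq {k a b : Fin n} (ha : IsLeast (D.block k : Set (Fin n)) a)
    (hb : IsGreatest (D.block k : Set (Fin n)) b) : ρ.blockLoop R k = D.arcProd R a b := by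
  have hca : D.center a = D.center k := D.mem_block.1 ha.1
  have hcb : D.center b = D.center k := D.mem_block.1 hb.1
  have hlt := ρ.lt
  have hpos := ρ.pos
  rw [blockLoop, arcProd, D.gate_eq R (g := D.center k - _) (g' := A.pt D.x a - D.radius a),
    D.gate_eq R (g := D.center k + _) (g' := A.pt D.x b + D.radius b)]
  · intro l
    have hl' := abs_lt.1 (ρ.abs_pt_sub_center_lt l)
    rcases le_or_gt l b with hl | hl
    · have := ρ.center_monotone hl
      exact .inl ⟨by linarith [hl'.2], D.lt_add_radius hl⟩
    · have h1 : D.center k < D.center l :=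
        (hcb.symm.trans_le (ρ.center_monotone hl.le)).lt_of_ne
          fun h => (hb.2 (D.mem_block.2 h.symm)).not_gt hl
      have h2 := ρ.sep_center h1
      exact .inr ⟨by linarith [hl'.1], D.add_radius_lt hl⟩
  · intro l
    have hl' := abs_lt.1 (ρ.abs_pt_sub_center_lt l)
    rcases lt_or_ge l a with hl | hl
    · have h1 : D.center l < D.center k :=
        ((ρ.center_monotone hl.le).trans_eq hca).lt_of_ne
          fun h => (ha.2 (D.mem_block.2 h)).not_gt hl
      have h2 := ρ.sep_center h1
      exact .inl ⟨by linarith [hl'.2], D.lt_sub_radius hl⟩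
    · have := ρ.center_monotone hl
      exact .inr ⟨by linarith [hl'.1], D.sub_radius_lt hl⟩

/-- Blocks are level sets of the monotone function `center`. -/
theorem block_eq_Icc (ρ : D.Radii) {k a b : Fin n} (ha : IsLeast (D.block k : Set (Fin n)) a)
    (hb : IsGreatest (D.block k : Set (Fin n)) b) : D.block k = Finset.Icc a b := by
  ext l
  rw [Finset.mem_Icc]
  refine ⟨fun hl => ⟨ha.2 hl, hb.2 hl⟩, fun hl => D.mem_block.2 (le_antisymm ?_ ?_)⟩
  · exact (ρ.center_monotone hl.2).trans_eq (D.mem_block.1 hb.1)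
  · exact (D.mem_block.1 ha.1).symm.trans_le (ρ.center_monotone hl.1)

end Radii

end PathRep

/-! ### The formulas for the local monodromy -/

variable {L : RankOneLocalSystem ℂ A.compl} (hs : ∀ k, (D.param L k : ℂ) ≠ 1)

/-- The class of `α_k / (1 - s_k)` modulo boundaries. -/
def normLoop (L : RankOneLocalSystem ℂ A.compl) (k : Fin n) :
    ChainClasses (A.fiberSystem L D.x) :=
  (1 - (D.param L k : ℂ))⁻¹ • cls (A.fiberSystem L D.x) (D.loop k)

theorem exists_cycle_alpha (i j : Fin n) : ∃ z : Cycles (A.fiberSystem L D.x),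
    D.alpha hs i j = Submodule.Quotient.mk z ∧ cyclesIncl (A.fiberSystem L D.x) z =
      Finsupp.single (D.loop i) (1 - (D.param L i : ℂ))⁻¹
        - Finsupp.single (D.loop j) (1 - (D.param L j : ℂ))⁻¹ := ⟨_, rfl, rfl⟩

theorem toChainClasses_alpha (i j : Fin n) :
    toChainClasses _ (D.alpha hs i j) = D.normLoop L i - D.normLoop L j := by
  obtain ⟨z, hz, hz'⟩ := D.exists_cycle_alpha hs i j
  rw [hz, toChainClasses_mk, hz', Submodule.Quotient.mk_sub, mk_single, mk_single, normLoop, normLoop]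

/-- All elementary loops start at `y₀`, where the change of stalks is `1`; the twist thus acts on
them without extra factors. -/
theorem toChainClasses_monodromy_alpha (ρ : D.Radii) (i j : Fin n) :
    toChainClasses _ (D.monodromy L (D.alpha hs i j)) =
      (1 - (D.param L i : ℂ))⁻¹ • cls (A.fiberSystem L D.x) (ρ.twist.comp (D.loop i)) -
      (1 - (D.param L j : ℂ))⁻¹ • cls (A.fiberSystem L D.x) (ρ.twist.comp (D.loop j)) := by
  obtain ⟨u, h, hu, hmon⟩ := ρ.exists_monodromy_eq L
  have h0 : ∀ k, u (D.loop k 0) = 1 := fun k => by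
    rw [← hu]
    congr 1
    exact Subtype.ext (by change D.loopInPlane k 0 = _; simp)
  rw [hmon]
  obtain ⟨z, hz, hz'⟩ := D.exists_cycle_alpha hs i j
  rw [hz, toChainClasses_twMap, hz', map_sub, Submodule.Quotient.mk_sub, twChain_single, twChain_single, h0, h0, Units.val_one,
    mul_one, mul_one, mk_single, mk_single]

/-- The path invariant given by transport and classes modulo boundaries. -/
abbrev fiberRep (L : RankOneLocalSystem ℂ A.compl) :
    PathRep (A.Fiber D.x) (AffineElement ℂ (ChainClasses (A.fiberSystem L D.x))) :=
  affineRep (A.fiberSystem L D.x)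

/-- The right side is the affine map of the block loop applied to `normLoop`: dividing `shift_conj`
by `1 - s_k` removes the factor of the shift. -/
theorem normLoop_twist (hs : ∀ k, (D.param L k : ℂ) ≠ 1) (ρ : D.Radii) (k : Fin n) :
    (1 - (D.param L k : ℂ))⁻¹ • cls (A.fiberSystem L D.x) (ρ.twist.comp (D.loop k)) =
      (ρ.blockLoop (D.fiberRep L) k).shift +
        ((ρ.blockLoop (D.fiberRep L) k).mult : ℂ) • D.normLoop L k := by
  have hk : 1 - (D.param L k : ℂ) ≠ 0 := sub_ne_zero.2 (hs k).symm
  have h := congrArg AffineElement.shift (ρ.val_twist_loop (D.fiberRep L) k)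
  rw [AffineElement.shift_conj] at h
  change cls _ _ = (1 - (D.param L k : ℂ)) • _ + _ • cls (A.fiberSystem L D.x) (D.loop k) at h
  rw [h, smul_add, smul_smul, inv_mul_cancel₀ hk, one_smul, normLoop, Units.smul_def, smul_comm]

theorem arcProd_self (k : Fin n) : D.arcProd (D.fiberRep L) k k =
    ⟨D.param L k, cls (A.fiberSystem L D.x) (D.loop k)⟩ := (D.val_loop (D.fiberRep L) k).symm

theorem shift_arcProd_self (hs : ∀ k, (D.param L k : ℂ) ≠ 1) (k : Fin n) : (D.arcProd (D.fiberRep L) k k).shift =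
    (1 - ((D.arcProd (D.fiberRep L) k k).mult : ℂ)) • D.normLoop L k := by
  have hk : 1 - (D.param L k : ℂ) ≠ 0 := sub_ne_zero.2 (hs k).symm
  rw [arcProd_self, normLoop, smul_smul, mul_inv_cancel₀ hk, one_smul]

/-- The same affine map moves both terms of the difference, so only its linear part remains. -/
theorem monodromy_alpha_of_mem_block (ρ : D.Radii) {i j : Fin n} (hij : j ∈ D.block i) :
    D.monodromy L (D.alpha hs i j) =
      (∏ k ∈ D.block i, (D.param L k : ℂ)) • D.alpha hs i j := by
  have hi : i ∈ D.block i := D.mem_block.2 rfl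
  have ha := (D.block i).isLeast_min' ⟨i, hi⟩
  have hb := (D.block i).isGreatest_max' ⟨i, hi⟩
  have hji : ρ.blockLoop (D.fiberRep L) j = ρ.blockLoop (D.fiberRep L) i := by
    rw [Radii.blockLoop, Radii.blockLoop, D.mem_block.1 hij]
  have hm := AffineElement.mult_eq_prod (D.arcProd_mul (D.fiberRep L)) (ha.2 hb.1)
  simp only [arcProd_self] at hm
  apply toChainClasses_injective
  rw [D.toChainClasses_monodromy_alpha hs ρ, D.normLoop_twist hs, D.normLoop_twist hs, hji,
    map_smul, toChainClasses_alpha, ρ.block_eq_Icc ha hb, ← hm, ρ.blockLoop_eq _ ha hb, smul_sub]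
  abel

theorem monodromy_alpha_of_notMem_block (ρ : D.Radii) {i j a b : Fin n} (h : (i : ℕ) + 1 = j)
    (hij : j ∉ D.block i) (ha : IsLeast (D.block i : Set (Fin n)) a)
    (hb : IsGreatest (D.block j : Set (Fin n)) b) :
    D.monodromy L (D.alpha hs i j) =
      D.alpha hs i j
      + ∑ k ∈ Finset.Ico a i,
          (1 - ∏ l ∈ Finset.Icc a k, (D.param L l : ℂ)) • D.alpha hs k (Order.succ k)
      + ∑ k ∈ Finset.Ioc j b,
          ((∏ l ∈ Finset.Ico j k, (D.param L l : ℂ)) *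
            (1 - ∏ l ∈ Finset.Icc k b, (D.param L l : ℂ))) •
            D.alpha hs (Order.pred k) k := by
  -- Centers are monotone, so a later index in the block of `i` would force `j` into it;
  -- symmetrically `j` is the least of its block.
  have hi : IsGreatest (D.block i : Set (Fin n)) i := by
    refine ⟨D.mem_block.2 rfl, fun k hk => not_lt.1 fun hik => hij (D.mem_block.2 ?_)⟩
    have hjk : j ≤ k := Fin.le_def.2 (by have := Fin.lt_def.1 hik; omega)
    have hle : i ≤ j := Fin.le_def.2 (by omega)
    exact le_antisymm ((ρ.center_monotone hjk).trans_eq (D.mem_block.1 hk)) (ρ.center_monotone hle)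
  have hj : IsLeast (D.block j : Set (Fin n)) j := by
    refine ⟨D.mem_block.2 rfl, fun k hk => not_lt.1 fun hkj => hij (D.mem_block.2 ?_)⟩
    have hki : k ≤ i := Fin.le_def.2 (by have := Fin.lt_def.1 hkj; omega)
    have hle : i ≤ j := Fin.le_def.2 (by omega)
    exact le_antisymm ((D.mem_block.1 hk).symm.trans_le (ρ.center_monotone hki))
      (ρ.center_monotone hle)
  have e1 := AffineElement.shift_add_mult_smul_last (D.shift_arcProd_self hs)
    (D.arcProd_mul (D.fiberRep L)) (ha.2 hi.1)
  have e2 := AffineElement.shift_add_mult_smul_first (D.shift_arcProd_self hs)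
    (D.arcProd_mul (D.fiberRep L)) (hj.2 hb.1)
  simp only [arcProd_self] at e1 e2
  apply toChainClasses_injective
  simp only [map_add, map_sum, map_smul, toChainClasses_alpha]
  rw [D.toChainClasses_monodromy_alpha hs ρ, D.normLoop_twist hs, D.normLoop_twist hs,
    ρ.blockLoop_eq _ ha hi, ρ.blockLoop_eq _ hj hb, e1, e2]
  abel

end LocalData

end LineArrangement

end

theorem mainTheorem8 {n m : ℕ} (A : LineArrangement n m) (hA : A.Fibered)
    (p : ℝ) (hp : (p : ℂ) ∈ A.singProj) :
    ∃ ε > 0, ∀ D : A.LocalData hp, |D.x - p| < ε →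
      ∀ (L : RankOneLocalSystem ℂ A.compl) (hs : ∀ k, (D.param L k : ℂ) ≠ 1),
        Function.Bijective (D.monodromy L) ∧
        ∀ i j : Fin n, (i : ℕ) + 1 = j →
          (j ∈ D.block i →
            D.monodromy L (D.alpha hs i j) =
              (∏ k ∈ D.block i, (D.param L k : ℂ)) • D.alpha hs i j) ∧
          (j ∉ D.block i → ∀ a b : Fin n,
            IsLeast (D.block i : Set (Fin n)) a → IsGreatest (D.block j : Set (Fin n)) b →
            D.monodromy L (D.alpha hs i j) =
              D.alpha hs i j
              + ∑ k ∈ Finset.Ico a i,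
                  (1 - ∏ l ∈ Finset.Icc a k, (D.param L l : ℂ)) • D.alpha hs k (Order.succ k)
              + ∑ k ∈ Finset.Ioc j b,
                  ((∏ l ∈ Finset.Ico j k, (D.param L l : ℂ)) *
                    (1 - ∏ l ∈ Finset.Icc k b, (D.param L l : ℂ))) •
                    D.alpha hs (Order.pred k) k) := by
  obtain ⟨ε, hε, h⟩ := LineArrangement.LocalData.exists_radii A hp
  refine ⟨ε, hε, fun D hD L hs => ?_⟩
  obtain ⟨ρ⟩ := h D hD
  exact ⟨ρ.monodromy_bijective L, fun i j hij => ⟨D.monodromy_alpha_of_mem_block hs ρ,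
    fun hj a b ha hb => D.monodromy_alpha_of_notMem_block hs ρ hij hj ha hb⟩⟩
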